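/- **Setting.** Let $(\mathcal X,\mathcal A)$ be a measurable space, let $\Theta$ be a non-empty pseudo-metric space with its Borel $\sigma$-algebra, for each $\theta\in\Theta$ let $\mathcal P_\theta$ be a family of probability measures on $\mathcal X$, and let $L:\Theta\times\Theta\to[0,\infty)$ be a loss function. For $\delta\in(0,1]$ the minimax $(1-\delta)$th quantile is $$\mathcal M(\delta,\mathcal P_\Theta,L):=\inf_{\widehat\theta}\ \sup_{\theta\in\Theta}\ \sup_{P\in\mathcal P_\theta}\ \inf\bigl\{r\in[0,\infty): P\{L(\widehat\theta,\theta)\le r\}\ge 1-\delta\bigr\},$$ where the first infimum is over all estimators, i.e. all measurable maps $\widehat\theta:\mathcal X\to\Theta$. For $\beta,\gamma>0$ and $m:=\lceil\beta\rceil-1$, the Hölder class $\mathcal F(\beta,\gamma)$ is the set of all Borel measurable $f:\mathbb R\to[0,\infty)$ with $\int_{\mathbb R}f=1$ that are $m$-times differentiable and satisfy $|f^{(m)}(x)-f^{(m)}(x')|\le\gamma|x-x'|^{\beta-m}$ for all $x,x'\in\mathbb R$. **Proposition.** For every $\beta>0$ there exist constants $c(\beta),C(\beta)>0$, depending only on $\beta$,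 such that the following holds for every $\gamma>0$, every integer $n\ge 1$ and every $x_0\in\mathbb R$. Let $\Theta:=\mathcal F(\beta,\gamma)$ with the pseudo-metric $d(f_1,f_2):=|f_1(x_0)-f_2(x_0)|$, let $L(f_1,f_2):=\{f_1(x_0)-f_2(x_0)\}^2$, and for $f\in\Theta$ let $\mathcal P_f:=\{P_f^{\otimes n}\}$, where $P_f$ is the distribution with density $f$. Write $a\wedge b:=\min(a,b)$. Then, for every $\delta\in(0,1/4]$, $$c(\beta)\,\gamma^{2/(\beta+1)}\Bigl\{\Bigl(\tfrac{\log(1/\delta)}{n}\Bigr)^{2\beta/(2\beta+1)}\wedge 1\Bigr\}\ \le\ \mathcal M(\delta,\mathcal P_\Theta,L)\ \le\ C(\beta)\,\gamma^{2/(\beta+1)}\Bigl\{\Bigl(\tfrac{\log(1/\delta)}{n}\Bigr)^{2\beta/(2\beta+1)}\wedge 1\Bigr\}.$$ Moreover, the upper bound is attained by an estimator that does not depend on $\delta$: there is a single estimator $\widehat f$, i.e. a measurable map from $\mathbb R^n$ to $\Theta$ (which may depend on $n,\beta,\gamma,x_0$), such that for every $\delta\in(0,1/4]$ and every $f\in\mathcal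 F(\beta,\gamma)$, the $(1-\delta)$th quantile $\inf\{r\in[0,\infty):P_f^{\otimes n}\{L(\widehat f,f)\le r\}\ge 1-\delta\}$ of its loss is at most $C(\beta)\,\gamma^{2/(\beta+1)}\bigl\{\bigl(\tfrac{\log(1/\delta)}{n}\bigr)^{2\beta/(2\beta+1)}\wedge 1\bigr\}$. -/

import Mathlib

open MeasureTheory
open scoped ENNReal NNReal

noncomputable section

/-- The `(1 - δ)`th quantile of a nonnegative loss `ℓ` (a function of the data) under `P`:
`inf {r ∈ [0, ∞) : P {ℓ ≤ r} ≥ 1 - δ}`, as an element of `[0, ∞]`. -/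
def lossQuantile {X : Type*} [MeasurableSpace X] (δ : ℝ) (P : Measure X) (ℓ : X → ℝ) : ℝ≥0∞ :=
  ⨅ (r : ℝ≥0) (_ : ENNReal.ofReal (1 - δ) ≤ P {x | ℓ x ≤ (r : ℝ)}), (r : ℝ≥0∞)

/-- The largest `(1 - δ)`th quantile of the loss `L (est, θ)` of an estimator `est`, over all
parameters `θ` and all distributions `P ∈ 𝓟 θ`. -/
def worstCaseQuantile {X Θ : Type*} [MeasurableSpace X] (δ : ℝ) (𝓟 : Θ → Set (Measure X))
    (L : Θ → Θ → ℝ) (est : X → Θ) : ℝ≥0∞ :=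
  ⨆ (θ : Θ) (P ∈ 𝓟 θ), lossQuantile δ P (fun x => L (est x) θ)

/-- The minimax `(1 - δ)`th quantile `ℳ(δ, 𝓟, L)`: the infimum of the worst-case quantile over all
estimators, i.e. all measurable maps from the sample space `X` to the parameter space `Θ`. -/
def minimaxQuantile {X Θ : Type*} [MeasurableSpace X] [MeasurableSpace Θ] (δ : ℝ)
    (𝓟 : Θ → Set (Measure X)) (L : Θ → Θ → ℝ) : ℝ≥0∞ :=
  ⨅ (est : X → Θ) (_ : Measurable est), worstCaseQuantile δ 𝓟 L est

/-- `f` belongs to the Hölder class `ℱ(β, γ)` of densities on the real line. With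
`m = ⌈β⌉ - 1`, it is an `m`-times differentiable probability density whose `m`th derivative is
`(β - m)`-Hölder with constant `γ`. (The integral being `1` forces `f` to be integrable.) -/
structure IsHolderDensity (β γ : ℝ) (f : ℝ → ℝ) : Prop where
  measurable : Measurable f
  nonneg : ∀ x, 0 ≤ f x
  integral_eq_one : ∫ x, f x = 1
  differentiable : ∀ k < ⌈β⌉₊ - 1, Differentiable ℝ (iteratedDeriv k f)
  holder : ∀ x x' : ℝ,
    |iteratedDeriv (⌈β⌉₊ - 1) f x - iteratedDeriv (⌈β⌉₊ - 1) f x'| ≤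
      γ * |x - x'| ^ (β - ((⌈β⌉₊ - 1 : ℕ) : ℝ))

/-- The parameter space: the set `ℱ(β, γ)`, made into a type. The point `x₀` only enters through the
pseudo-metric `d(f₁, f₂) = |f₁(x₀) - f₂(x₀)|` that is put on it below. -/
def HolderDensityAt (β γ _x₀ : ℝ) : Type :=
  {f : ℝ → ℝ // IsHolderDensity β γ f}

instance HolderDensityAt.instPseudoMetricSpace (β γ x₀ : ℝ) :
    PseudoMetricSpace (HolderDensityAt β γ x₀) :=
  PseudoMetricSpace.induced (fun f => f.1 x₀) inferInstance

/-- The Borel `σ`-algebra of the pseudo-metric. -/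
instance HolderDensityAt.instMeasurableSpace (β γ x₀ : ℝ) :
    MeasurableSpace (HolderDensityAt β γ x₀) :=
  borel (HolderDensityAt β γ x₀)

/-- For a density `f`, the family `{P_f^{⊗ n}}`, with `P_f` the distribution with density `f`. -/
def iidModel (β γ x₀ : ℝ) (n : ℕ) (f : HolderDensityAt β γ x₀) : Set (Measure (Fin n → ℝ)) :=
  {Measure.pi (fun _ : Fin n => volume.withDensity (fun x => ENNReal.ofReal (f.1 x)))}

/-- Squared error loss at the point `x₀`. -/
def pointLoss (β γ x₀ : ℝ) (f₁ f₂ : HolderDensityAt β γ x₀) : ℝ :=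
  (f₁.1 x₀ - f₂.1 x₀) ^ 2

/-- The rate `γ ^ (2 / (β + 1)) * {(log (1 / δ) / n) ^ (2 β / (2 β + 1)) ∧ 1}`. -/
def kdeRate (β γ : ℝ) (n : ℕ) (δ : ℝ) : ℝ :=
  γ ^ (2 / (β + 1)) * min ((Real.log (1 / δ) / (n : ℝ)) ^ (2 * β / (2 * β + 1))) 1

end

/-!
Write `m = ⌈β⌉ - 1` and `θ = γ ^ (1 / (β + 1))`, so that `1 / θ` is the length scale of the Hölder
class and `θ` its height scale; every bound below is stated for `γ = θ ^ (β + 1)`.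

**Upper bound.** By Taylor's theorem and the vanishing of the `(m + 1)`st forward difference on
polynomials of degree at most `m`, the averages of a Hölder function over `[x₀, x₀ + i h]`,
`1 ≤ i ≤ m + 1`, extrapolate to its value at `x₀` with an error of order `γ h ^ β`
(`abs_sub_sum_average_le`). With `h = 1 / θ` this bounds the densities of the class by a multiple of
`θ` (`IsHolderDensity.le_holderSup`). With the averages replaced by empirical ones it gives, for
each level `k ≤ n`, an estimator with `h` a multiple of `(k / n) ^ (1 / (2β + 1))` that is within a
radius `r k`, of order `θ (k / n) ^ (β / (2β + 1))`, of the truth up to probability `e⁻ᵏ / 2`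
(`averageEstimate_error`, from Bernstein's inequality for counts). An estimator that works for every
`δ` selects a density compatible with the estimates of all levels `j ≥ k`, for the smallest possible
`k` (`exists_measurable_selection`). The levels `j ≥ k := ⌈log (1 / δ)⌉` are all good up to
probability `e⁻ᵏ ≤ δ`, and then the selected density is within `3 r k` of the truth; when `k > n`
the uniform bound on the densities suffices.

**Lower bound.** A smooth density that is constant near `x₀` is perturbed by a function of height
proportional to `θ h ^ β`, width `h / θ` and integral zero (`exists_close_holderDensities`). The
affinity `∫ √(f₀ f₁)` of the two densities is at least `1 - h ^ (2β + 1) / 32`, and it is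
multiplicative under products. An estimator whose loss had a small `(1 - δ)`th quantile under both
hypotheses would provide a test with both errors at most `δ`, which forces the affinity of the
product measures below `√δ (2 - δ) < δ ^ (1 / 16)` (`affinity_le_of_test`, `sqrt_mul_two_sub_lt`).
For `h ^ (2β + 1) = min (log (1 / δ) / n) 1` this is impossible.
-/

/-! ### Extrapolation from averages -/

/-- Taylor's theorem for a function whose `m`th derivative is `α`-Hölder at `x₀`: to the right of
`x₀` the function is within `γ u ^ (α + m)` of a polynomial of degree at most `m`. -/
theorem exists_taylor_approx {α γ : ℝ} (hα : 0 < α) (hγ : 0 ≤ γ) (x₀ : ℝ) (m : ℕ) :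
    ∀ f : ℝ → ℝ, (∀ k < m, Differentiable ℝ (iteratedDeriv k f)) →
      (∀ x, |iteratedDeriv m f x - iteratedDeriv m f x₀| ≤ γ * |x - x₀| ^ α) →
      ∃ a : ℕ → ℝ, ∀ u : ℝ, 0 ≤ u →
        |f (x₀ + u) - ∑ j ∈ Finset.range (m + 1), a j * u ^ j| ≤ γ * u ^ (α + m) := by
  induction m with
  | zero =>
    intro f _ hf
    refine ⟨fun _ => f x₀, fun u hu => ?_⟩
    simpa [abs_of_nonneg hu] using hf (x₀ + u)
  | succ m ih =>
    intro f hd hf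
    obtain ⟨a, ha⟩ := ih (deriv f)
      (fun k hk => by simpa only [iteratedDeriv_succ'] using hd (k + 1) (by omega))
      (fun x => by simpa only [iteratedDeriv_succ'] using hf x)
    have hdf : Differentiable ℝ f := by simpa using hd 0 (by omega)
    -- integrate the approximating polynomial of the derivative, with constant term `f x₀`
    refine ⟨fun j => if j = 0 then f x₀ else a (j - 1) / j, fun u hu => ?_⟩
    set T : ℝ → ℝ := fun v => f x₀ + ∑ j ∈ Finset.range (m + 1), a j / (j + 1 : ℝ) * v ^ (j + 1)
      with hT
    have hTeq : ∀ v, ∑ j ∈ Finset.range (m + 1 + 1),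
        (if j = 0 then f x₀ else a (j - 1) / j) * v ^ j = T v := by
      intro v
      rw [Finset.sum_range_succ', hT, add_comm]
      simp
    have hTd : ∀ v, HasDerivAt T (∑ j ∈ Finset.range (m + 1), a j * v ^ j) v := by
      intro v
      refine HasDerivAt.const_add _ (HasDerivAt.fun_sum fun j _ => ?_)
      have := (hasDerivAt_pow (j + 1) v).const_mul (a j / (j + 1 : ℝ))
      refine this.congr_deriv ?_
      have : (j + 1 : ℝ) ≠ 0 := by positivity
      rw [Nat.add_sub_cancel]
      push_cast
      field_simp
    have hgd : ∀ v, HasDerivAt (fun v => f (x₀ + v) - T v)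
        (deriv f (x₀ + v) - ∑ j ∈ Finset.range (m + 1), a j * v ^ j) v := fun v =>
      ((hdf (x₀ + v)).hasDerivAt.comp_const_add x₀ v).sub (hTd v)
    rcases hu.eq_or_lt with rfl | hu'
    · rw [hTeq]
      have : (0 : ℝ) ^ (α + (m + 1 : ℕ)) = 0 := Real.zero_rpow (by positivity)
      rw [this]
      simp [hT]
    have key := norm_image_sub_le_of_norm_deriv_le_segment' (f := fun v => f (x₀ + v) - T v)
      (a := 0) (b := u) (C := γ * u ^ (α + m)) (fun v _ => (hgd v).hasDerivWithinAt)
      (fun v hv => (ha v hv.1).trans (by gcongr; exacts [hv.1, hv.2.le])) u ⟨hu, le_rfl⟩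
    rw [hTeq]
    have h0 : f (x₀ + 0) - T 0 = 0 := by simp [hT]
    rw [h0, sub_zero, sub_zero, Real.norm_eq_abs] at key
    refine key.trans_eq ?_
    push_cast
    rw [← add_assoc, Real.rpow_add_one hu'.ne', mul_assoc]

/-- The weights that extrapolate the values of a polynomial of degree at most `m` at
`s, 2s, …, (m + 1)s` to its value at `0`; they come from the vanishing of the `(m + 1)`st forward
difference. The index `i` stands for the node `(i + 1)s`. -/
noncomputable def extrapolationWeight (m i : ℕ) : ℝ := (-1) ^ i * ((m + 1).choose (i + 1) : ℝ)

theorem sum_abs_extrapolationWeight_le (m : ℕ) :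
    ∑ i ∈ Finset.range (m + 1), |extrapolationWeight m i| ≤ 2 ^ (m + 1) := by
  have h := Nat.sum_range_choose (m + 1)
  rw [Finset.sum_range_succ'] at h
  have h' : ∑ i ∈ Finset.range (m + 1), (m + 1).choose (i + 1) ≤ 2 ^ (m + 1) := by omega
  simp only [extrapolationWeight, abs_mul, abs_pow, abs_neg, abs_one, one_pow, one_mul, Nat.abs_cast]
  exact_mod_cast h'

theorem sum_extrapolationWeight_polynomial (m : ℕ) (a : ℕ → ℝ) (s : ℝ) :
    ∑ i ∈ Finset.range (m + 1), extrapolationWeight m i *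
      ∑ j ∈ Finset.range (m + 1), a j * ((i + 1) * s) ^ j = a 0 := by
  have h := congrFun (fwdDiff_iter_sum_mul_pow_eq_zero (R := ℝ) (n := m + 1)
    (fun j => a j * s ^ j)) 0
  rw [fwdDiff_iter_eq_sum_shift, Finset.sum_range_succ'] at h
  have h0 : ∑ k ∈ Finset.range (m + 1), a k * s ^ k * (0 : ℝ) ^ k = a 0 := by
    rw [Finset.sum_range_succ']; simp
  simp only [zero_add, nsmul_eq_mul, mul_one, zsmul_eq_mul, Pi.zero_apply, Nat.cast_zero, h0, Nat.sub_zero,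
    Nat.choose_zero_right] at h
  have hs : (-1 : ℝ) ^ (m + 1) * (-1) ^ (m + 1) = 1 := by rw [← mul_pow]; simp
  have h2 : ∑ i ∈ Finset.range (m + 1), extrapolationWeight m i *
      ∑ j ∈ Finset.range (m + 1), a j * ((i + 1) * s) ^ j = - (-1) ^ (m + 1) *
      ∑ x ∈ Finset.range (m + 1), ((((-1) ^ (m + 1 - (x + 1)) * ((m + 1).choose (x + 1) : ℤ) : ℤ)) : ℝ)
        * ∑ k ∈ Finset.range (m + 1), a k * s ^ k * ((x + 1 : ℕ) : ℝ) ^ k := by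
    rw [Finset.mul_sum]
    refine Finset.sum_congr rfl fun i hi => ?_
    have hi' : i ≤ m := by simpa [Nat.lt_succ_iff] using hi
    have e1 : - (-1 : ℝ) ^ (m + 1) * (-1) ^ (m - i) = (-1) ^ i := by
      obtain ⟨d, rfl⟩ := Nat.exists_eq_add_of_le hi'
      have : i + d - i = d := by omega
      rw [this]
      have hd : (-1 : ℝ) ^ d * (-1) ^ d = 1 := by rw [← mul_pow]; simp
      rw [pow_succ, pow_add]; linear_combination (-1 : ℝ) ^ i * hd
    rw [extrapolationWeight, ← e1, Nat.add_sub_add_right]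
    push_cast
    have e2 : ∑ j ∈ Finset.range (m + 1), a j * (((i : ℝ) + 1) * s) ^ j =
        ∑ k ∈ Finset.range (m + 1), a k * s ^ k * ((i : ℝ) + 1) ^ k :=
      Finset.sum_congr rfl fun k _ => by rw [mul_pow]; ring
    rw [e2]; ring
  rw [h2]
  push_cast at h ⊢
  linear_combination (-(-1 : ℝ) ^ (m + 1)) * h + a 0 * hs

theorem abs_sub_sum_extrapolationWeight_le {α γ : ℝ} (hα : 0 < α) (hγ : 0 ≤ γ) (x₀ : ℝ) {m : ℕ}
    {f : ℝ → ℝ} (hd : ∀ k < m, Differentiable ℝ (iteratedDeriv k f))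
    (hf : ∀ x, |iteratedDeriv m f x - iteratedDeriv m f x₀| ≤ γ * |x - x₀| ^ α) {s h : ℝ}
    (hs : 0 ≤ s) (hsh : s ≤ h) :
    |f x₀ - ∑ i ∈ Finset.range (m + 1), extrapolationWeight m i * f (x₀ + (i + 1) * s)| ≤
      2 ^ (m + 1) * (γ * ((m + 1) * h) ^ (α + m)) := by
  obtain ⟨a, ha⟩ := exists_taylor_approx hα hγ x₀ m f hd hf
  have h0 : f x₀ = a 0 := by
    have := ha 0 le_rfl
    rw [Real.zero_rpow (by positivity), Finset.sum_range_succ'] at this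
    simp at this
    linarith
  rw [h0, ← sum_extrapolationWeight_polynomial m a s, ← Finset.sum_sub_distrib]
  simp_rw [← mul_sub]
  refine (Finset.abs_sum_le_sum_abs _ _).trans ?_
  refine le_trans (Finset.sum_le_sum (g := fun i => |extrapolationWeight m i| *
    (γ * ((m + 1) * h) ^ (α + m))) fun i hi => ?_) ?_
  · rw [abs_mul, abs_sub_comm]
    gcongr
    refine (ha ((i + 1) * s) (by positivity)).trans ?_
    have : (i : ℝ) ≤ m := by exact_mod_cast Nat.lt_succ_iff.1 (Finset.mem_range.1 hi)
    gcongr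
  · rw [← Finset.sum_mul]
    have : 0 ≤ h := hs.trans hsh
    gcongr
    exact sum_abs_extrapolationWeight_le m

/-- The value of a Hölder function at `x₀` is extrapolated from its averages over the intervals
`[x₀, x₀ + (i + 1) h]`. -/
theorem abs_sub_sum_average_le {α γ : ℝ} (hα : 0 < α) (hγ : 0 ≤ γ) (x₀ : ℝ) {m : ℕ}
    {f : ℝ → ℝ} (hc : Continuous f) (hd : ∀ k < m, Differentiable ℝ (iteratedDeriv k f))
    (hf : ∀ x, |iteratedDeriv m f x - iteratedDeriv m f x₀| ≤ γ * |x - x₀| ^ α) {h : ℝ}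
    (hh : 0 < h) :
    |f x₀ - ∑ i ∈ Finset.range (m + 1), extrapolationWeight m i *
      (((i + 1) * h)⁻¹ * ∫ x in x₀..x₀ + (i + 1) * h, f x)| ≤
      2 ^ (m + 1) * (γ * ((m + 1) * h) ^ (α + m)) := by
  have hint : ∀ i : ℕ, ((i + 1) * h)⁻¹ * ∫ x in x₀..x₀ + (i + 1) * h, f x =
      ∫ v in (0 : ℝ)..1, f (x₀ + (i + 1) * (h * v)) := by
    intro i
    have hne : ((i : ℝ) + 1) * h ≠ 0 := by positivity
    have := intervalIntegral.integral_comp_add_mul (a := 0) (b := 1) f hne x₀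
    simp only [mul_zero, add_zero, mul_one, smul_eq_mul] at this
    rw [← this]
    simp only [mul_assoc]
  have hci : ∀ i : ℕ, IntervalIntegrable
      (fun v => extrapolationWeight m i * f (x₀ + (i + 1) * (h * v))) volume 0 1 := fun i =>
    (by fun_prop : Continuous _).intervalIntegrable _ _
  have heq : f x₀ - ∑ i ∈ Finset.range (m + 1), extrapolationWeight m i *
      (((i + 1) * h)⁻¹ * ∫ x in x₀..x₀ + (i + 1) * h, f x) =
      ∫ v in (0 : ℝ)..1, (f x₀ - ∑ i ∈ Finset.range (m + 1),
        extrapolationWeight m i * f (x₀ + (i + 1) * (h * v))) := by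
    rw [intervalIntegral.integral_sub (by simp)
      ((by fun_prop : Continuous _).intervalIntegrable _ _),
      intervalIntegral.integral_finsetSum fun i _ => hci i]
    simp only [hint, intervalIntegral.integral_const_mul]
    simp
  rw [heq, ← Real.norm_eq_abs]
  refine (intervalIntegral.norm_integral_le_of_norm_le_const
    (C := 2 ^ (m + 1) * (γ * ((m + 1) * h) ^ (α + m))) fun v hv => ?_).trans_eq (by simp)
  rw [Set.uIoc_of_le zero_le_one] at hv
  exact abs_sub_sum_extrapolationWeight_le hα hγ x₀ hd hf (mul_nonneg hh.le hv.1.le)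
    (by nlinarith [hv.2])

/-! ### Hölder densities -/

theorem holder_exponent_pos {β : ℝ} (hβ : 0 < β) : 0 < β - ((⌈β⌉₊ - 1 : ℕ) : ℝ) := by
  have h1 : 1 ≤ ⌈β⌉₊ := Nat.one_le_ceil_iff.2 hβ
  rw [Nat.cast_sub h1]
  have := Nat.ceil_lt_add_one hβ.le
  push_cast
  linarith

theorem holder_exponent_le_one {β : ℝ} (hβ : 0 < β) : β - ((⌈β⌉₊ - 1 : ℕ) : ℝ) ≤ 1 := by
  have h1 : 1 ≤ ⌈β⌉₊ := Nat.one_le_ceil_iff.2 hβ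
  rw [Nat.cast_sub h1]
  have := Nat.le_ceil β
  push_cast
  linarith

theorem continuous_of_abs_sub_le_rpow {g : ℝ → ℝ} {γ α : ℝ} (hα : 0 < α)
    (h : ∀ x y, |g x - g y| ≤ γ * |x - y| ^ α) : Continuous g := by
  rw [continuous_iff_continuousAt]
  intro y
  rw [ContinuousAt, tendsto_iff_dist_tendsto_zero]
  have hlim : Filter.Tendsto (fun x => γ * |x - y| ^ α) (nhds y) (nhds 0) := by
    have : Continuous fun x => γ * |x - y| ^ α :=
      continuous_const.mul ((continuous_abs.comp (continuous_id.sub continuous_const)).rpow_const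
        fun _ => Or.inr hα.le)
    simpa [hα.ne'] using this.tendsto y
  exact squeeze_zero (fun _ => dist_nonneg) (fun x => by rw [Real.dist_eq]; exact h x y) hlim

theorem IsHolderDensity.continuous {β γ : ℝ} {f : ℝ → ℝ} (hβ : 0 < β)
    (hf : IsHolderDensity β γ f) : Continuous f := by
  rcases Nat.eq_zero_or_pos (⌈β⌉₊ - 1) with h0 | h0
  · refine continuous_of_abs_sub_le_rpow (γ := γ) (holder_exponent_pos hβ) fun x y => ?_
    simpa [h0] using hf.holder x y
  · simpa using (hf.differentiable 0 h0).continuous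

theorem IsHolderDensity.integrable {β γ : ℝ} {f : ℝ → ℝ} (hf : IsHolderDensity β γ f) :
    Integrable f := integrable_of_integral_eq_one hf.integral_eq_one

/-- The distribution on the real line with density `f`. -/
noncomputable abbrev densityLaw (f : ℝ → ℝ) : Measure ℝ :=
  volume.withDensity fun x => ENNReal.ofReal (f x)

theorem isProbabilityMeasure_densityLaw {f : ℝ → ℝ} (hf0 : ∀ x, 0 ≤ f x)
    (hf1 : ∫ x, f x = 1) : IsProbabilityMeasure (densityLaw f) := by
  refine ⟨?_⟩
  rw [withDensity_apply _ MeasurableSet.univ, Measure.restrict_univ,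
    ← ofReal_integral_eq_lintegral_ofReal (integrable_of_integral_eq_one hf1)
      (Filter.Eventually.of_forall hf0), hf1, ENNReal.ofReal_one]

theorem IsHolderDensity.isProbabilityMeasure {β γ : ℝ} {f : ℝ → ℝ} (hf : IsHolderDensity β γ f) :
    IsProbabilityMeasure (densityLaw f) :=
  isProbabilityMeasure_densityLaw hf.nonneg hf.integral_eq_one

theorem IsHolderDensity.densityLaw_real_Ioc {β γ : ℝ} {f : ℝ → ℝ} (hf : IsHolderDensity β γ f)
    {a b : ℝ} (hab : a ≤ b) : (densityLaw f).real (Set.Ioc a b) = ∫ x in a..b, f x := by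
  rw [measureReal_def, withDensity_apply _ measurableSet_Ioc,
    ← ofReal_integral_eq_lintegral_ofReal hf.integrable.integrableOn
      (Filter.Eventually.of_forall hf.nonneg), intervalIntegral.integral_of_le hab,
    ENNReal.toReal_ofReal (integral_nonneg hf.nonneg)]

/-- The bias of the extrapolated averages with bandwidth `u / θ`, where `θ ^ (β + 1)` is the
Hölder constant. -/
theorem IsHolderDensity.abs_sub_sum_average_le {β θ u : ℝ} {f : ℝ → ℝ} (hβ : 0 < β) (hθ : 0 < θ)
    (hu : 0 < u) (hf : IsHolderDensity β (θ ^ (β + 1)) f) (x₀ : ℝ) :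
    |f x₀ - ∑ i ∈ Finset.range (⌈β⌉₊ - 1 + 1), extrapolationWeight (⌈β⌉₊ - 1) i *
      (((i + 1) * (u / θ))⁻¹ * (densityLaw f).real (Set.Ioc x₀ (x₀ + (i + 1) * (u / θ))))| ≤
      2 ^ (⌈β⌉₊ - 1 + 1) * (((⌈β⌉₊ - 1 : ℕ) : ℝ) + 1) ^ β * (θ * u ^ β) := by
  have h := _root_.abs_sub_sum_average_le (holder_exponent_pos hβ)
    (Real.rpow_nonneg hθ.le (β + 1)) x₀ (hf.continuous hβ) hf.differentiable
    (fun x => hf.holder x x₀) (div_pos hu hθ)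
  have hI : ∀ i : ℕ, (densityLaw f).real (Set.Ioc x₀ (x₀ + (i + 1) * (u / θ))) =
      ∫ x in x₀..x₀ + (i + 1) * (u / θ), f x := fun i =>
    hf.densityLaw_real_Ioc (le_add_of_nonneg_right (by positivity))
  simp_rw [hI]
  refine h.trans_eq ?_
  rw [sub_add_cancel, Real.mul_rpow (by positivity) (by positivity), Real.div_rpow hu.le hθ.le,
    Real.rpow_add_one hθ.ne']
  have : θ ^ β ≠ 0 := (Real.rpow_pos_of_pos hθ β).ne'
  field_simp

/-- The constant of the uniform bound on Hölder densities. -/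
noncomputable def holderSup (β : ℝ) : ℝ :=
  2 ^ (⌈β⌉₊ - 1 + 1) * (1 + (((⌈β⌉₊ - 1 : ℕ) : ℝ) + 1) ^ β)

theorem one_le_holderSup (β : ℝ) : 1 ≤ holderSup β := by
  have h1 : (1 : ℝ) ≤ 2 ^ (⌈β⌉₊ - 1 + 1) := one_le_pow₀ (by norm_num)
  have h2 : (0 : ℝ) ≤ (((⌈β⌉₊ - 1 : ℕ) : ℝ) + 1) ^ β := by positivity
  rw [holderSup]
  nlinarith

/-- Extrapolating from averages, each at most the total mass over the length of the interval,
bounds a Hölder density uniformly. -/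
theorem IsHolderDensity.le_holderSup {β θ : ℝ} {f : ℝ → ℝ} (hβ : 0 < β) (hθ : 0 < θ)
    (hf : IsHolderDensity β (θ ^ (β + 1)) f) (x : ℝ) : f x ≤ holderSup β * θ := by
  have := hf.isProbabilityMeasure
  have h := hf.abs_sub_sum_average_le hβ hθ one_pos x
  have hs : |∑ i ∈ Finset.range (⌈β⌉₊ - 1 + 1), extrapolationWeight (⌈β⌉₊ - 1) i *
      (((i + 1) * (1 / θ))⁻¹ * (densityLaw f).real (Set.Ioc x (x + (i + 1) * (1 / θ))))| ≤
      2 ^ (⌈β⌉₊ - 1 + 1) * θ := by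
    refine (Finset.abs_sum_le_sum_abs _ _).trans ?_
    refine (Finset.sum_le_sum (g := fun i => |extrapolationWeight (⌈β⌉₊ - 1) i| * θ)
      fun i _ => ?_).trans ?_
    · rw [abs_mul, abs_of_nonneg (a := _ * _) (by positivity)]
      gcongr
      have h1 : ((i + 1) * (1 / θ))⁻¹ ≤ θ := by
        rw [mul_one_div, inv_div]
        exact div_le_self hθ.le (by linarith [(Nat.cast_nonneg i : (0 : ℝ) ≤ i)])
      exact (mul_le_mul h1 measureReal_le_one measureReal_nonneg hθ.le).trans_eq (mul_one θ)
    · rw [← Finset.sum_mul]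
      gcongr
      exact sum_abs_extrapolationWeight_le _
  rw [Real.one_rpow, mul_one] at h
  rw [holderSup]
  linarith [abs_le.1 h, abs_le.1 hs]

/-! ### Concentration of counts -/

/-- The number of the observations `x` that fall into `A`. -/
noncomputable def sampleCount {E : Type*} {n : ℕ} (A : Set E) (x : Fin n → E) : ℝ :=
  ∑ l, A.indicator 1 (x l)

theorem measurable_sampleCount {E : Type*} [MeasurableSpace E] {n : ℕ} {A : Set E}
    (hA : MeasurableSet A) : Measurable (sampleCount A : (Fin n → E) → ℝ) := by
  refine Finset.measurable_sum _ fun l _ => ?_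
  exact (measurable_one.indicator hA).comp (measurable_pi_apply l)

theorem integral_exp_mul_indicator_sub_le {E : Type*} [MeasurableSpace E] (P : Measure E)
    [IsProbabilityMeasure P] {A : Set E} (hA : MeasurableSet A) {t : ℝ} (ht : |t| ≤ 1) :
    ∫ x, Real.exp (t * (A.indicator 1 x - P.real A)) ∂P ≤ Real.exp (P.real A * t ^ 2) := by
  have h1 : ∀ x, Real.exp (t * (A.indicator 1 x - P.real A)) =
      Real.exp (-(t * P.real A)) * (1 + A.indicator (fun _ => Real.exp t - 1) x) := by
    intro x
    by_cases hx : x ∈ A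
    · simp [hx, ← Real.exp_add]; ring_nf
    · simp [hx]
  simp_rw [h1]
  rw [integral_const_mul, integral_add (integrable_const _)
    ((integrable_const _).indicator hA), integral_indicator_const _ hA]
  simp only [integral_const, probReal_univ, smul_eq_mul, mul_one]
  calc Real.exp (-(t * P.real A)) * (1 + P.real A * (Real.exp t - 1))
      ≤ Real.exp (-(t * P.real A)) * Real.exp (P.real A * (Real.exp t - 1)) := by
        gcongr
        linarith [Real.add_one_le_exp (P.real A * (Real.exp t - 1))]
    _ = Real.exp (P.real A * (Real.exp t - 1 - t)) := by rw [← Real.exp_add]; ring_nf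
    _ ≤ Real.exp (P.real A * t ^ 2) := by
        gcongr
        exact (le_abs_self _).trans (Real.abs_exp_sub_one_sub_id_le ht)

theorem measureReal_le_mul_sampleCount_sub_le {E : Type*} [MeasurableSpace E] (P : Measure E)
    [IsProbabilityMeasure P] {A : Set E} (hA : MeasurableSet A) (n : ℕ) {σ t s : ℝ}
    (hσ : |σ| = 1) (ht : 0 ≤ t) (ht1 : t ≤ 1) :
    (Measure.pi fun _ : Fin n => P).real {x | s ≤ σ * (sampleCount A x - n * P.real A)} ≤
      Real.exp (-t * s + n * P.real A * t ^ 2) := by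
  have hX : Measurable fun x : Fin n → E => σ * (sampleCount A x - n * P.real A) :=
    ((measurable_sampleCount hA).sub_const _).const_mul _
  have hexp : ∀ x : Fin n → E, Real.exp (t * (σ * (sampleCount A x - n * P.real A))) =
      ∏ l, Real.exp (t * σ * (A.indicator 1 (x l) - P.real A)) := by
    intro x
    rw [← Real.exp_sum, ← Finset.mul_sum, Finset.sum_sub_distrib]
    simp [sampleCount, mul_assoc]
  have hint1 : Integrable (fun x : E => Real.exp (t * σ * (A.indicator 1 x - P.real A))) P := by
    refine Integrable.of_bound (C := Real.exp 1) ?_ (Filter.Eventually.of_forall fun x => ?_)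
    · exact (((measurable_one.indicator hA).sub_const _).const_mul _).exp.aestronglyMeasurable
    · rw [Real.norm_eq_abs, Real.abs_exp, Real.exp_le_exp]
      refine (le_abs_self _).trans ?_
      rw [abs_mul, abs_mul, hσ, mul_one, abs_of_nonneg ht]
      have : |A.indicator (1 : E → ℝ) x - P.real A| ≤ 1 := by
        have h0 : 0 ≤ P.real A := measureReal_nonneg
        have h1 : P.real A ≤ 1 := measureReal_le_one
        by_cases hx : x ∈ A <;> simp [hx, abs_le] <;> linarith
      nlinarith [abs_nonneg (A.indicator (1 : E → ℝ) x - P.real A)]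
  refine (ProbabilityTheory.measure_ge_le_exp_mul_mgf s ht ?_).trans ?_
  · simp_rw [hexp]
    exact Integrable.fintype_prod (f := fun _ x => Real.exp (t * σ * (A.indicator 1 x - P.real A)))
      fun _ => hint1
  · rw [ProbabilityTheory.mgf]
    simp_rw [hexp]
    rw [integral_fintype_prod_eq_pow
      (fun x : E => Real.exp (t * σ * (A.indicator 1 x - P.real A))), Fintype.card_fin]
    have hσt : |t * σ| ≤ 1 := by rwa [abs_mul, hσ, mul_one, abs_of_nonneg ht]
    have hσ2 : σ ^ 2 = 1 := by rw [← sq_abs, hσ, one_pow]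
    rw [Real.exp_add]
    gcongr
    calc (∫ x, Real.exp (t * σ * (A.indicator 1 x - P.real A)) ∂P) ^ n
        ≤ Real.exp (P.real A * (t * σ) ^ 2) ^ n :=
          pow_le_pow_left₀ (integral_nonneg fun _ => (Real.exp_pos _).le)
            (integral_exp_mul_indicator_sub_le P hA hσt) n
      _ = Real.exp (n * P.real A * t ^ 2) := by
          rw [← Real.exp_nat_mul, mul_pow, hσ2]; ring_nf

/-- Bernstein's inequality for a count in the regime `k ≤ V`, in which its Gaussian term
dominates. -/
theorem measureReal_sqrt_le_abs_sampleCount_sub_le {E : Type*} [MeasurableSpace E] (P : Measure E)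
    [IsProbabilityMeasure P] {A : Set E} (hA : MeasurableSet A) (n : ℕ) {a k V : ℝ}
    (hV : 0 < V) (hnV : n * P.real A ≤ V) (hk : 0 ≤ k) (hkV : k ≤ V) :
    (Measure.pi fun _ : Fin n => P).real
      {x | (a + 1) * √(k * V) ≤ |sampleCount A x - n * P.real A|} ≤ 2 * Real.exp (-(a * k)) := by
  -- the exponent `-t s + V t²` is minimised at a multiple of `√(k / V)`
  set t := √(k / V)
  have ht : 0 ≤ t := Real.sqrt_nonneg _
  have ht1 : t ≤ 1 := Real.sqrt_le_one.2 ((div_le_one hV).2 hkV)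
  have ht2 : V * t ^ 2 = k := by rw [Real.sq_sqrt (by positivity)]; field_simp
  have hts : t * √(k * V) = k := by
    rw [← Real.sqrt_mul (by positivity), show k / V * (k * V) = k ^ 2 by field_simp,
      Real.sqrt_sq hk]
  have hone : ∀ σ : ℝ, |σ| = 1 → (Measure.pi fun _ : Fin n => P).real
      {x | (a + 1) * √(k * V) ≤ σ * (sampleCount A x - n * P.real A)} ≤ Real.exp (-(a * k)) := by
    intro σ hσ
    refine (measureReal_le_mul_sampleCount_sub_le P hA n hσ ht ht1).trans ?_
    rw [Real.exp_le_exp]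
    have : n * P.real A * t ^ 2 ≤ V * t ^ 2 := by gcongr
    have h3 : -t * ((a + 1) * √(k * V)) = -((a + 1) * k) := by
      linear_combination (-(a + 1)) * hts
    rw [h3]
    linarith
  have hsub : {x : Fin n → E | (a + 1) * √(k * V) ≤ |sampleCount A x - n * P.real A|} ⊆
      {x | (a + 1) * √(k * V) ≤ 1 * (sampleCount A x - n * P.real A)} ∪
      {x | (a + 1) * √(k * V) ≤ -1 * (sampleCount A x - n * P.real A)} := by
    intro x hx
    simp only [Set.mem_ofPred_eq, Set.mem_union] at hx ⊢
    rcases le_abs.1 hx with h | h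
    · left; linarith
    · right; linarith
  refine (measureReal_mono hsub).trans ((measureReal_union_le _ _).trans ?_)
  linarith [hone 1 (by simp), hone (-1) (by simp)]

/-! ### Selection of a parameter that fits all coarse scales -/

/-- Choose the smallest `k` such that some parameter is compatible with all the estimates `T j`,
`k ≤ j ≤ n`, up to twice their radii, and return such a parameter. Whatever the level `k` from
which on the estimates are good, the choice is as good as `T k`, without knowledge of `k`.
Searching a countable dense family of parameters makes the choice measurable. -/
theorem exists_measurable_selection {X Θ : Type*} [MeasurableSpace X] [MeasurableSpace Θ]
    [Nonempty Θ] (ev : Θ → ℝ) (n : ℕ) {T : ℕ → X → ℝ} (hT : ∀ k, Measurable (T k)) {r : ℕ → ℝ}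
    (hr : ∀ k, 1 ≤ k → 0 < r k) :
    ∃ est : X → Θ, Measurable est ∧ ∀ x θ k, 1 ≤ k → k ≤ n →
      (∀ j, k ≤ j → j ≤ n → |T j x - ev θ| ≤ r j) → |ev (est x) - ev θ| ≤ 3 * r k := by
  classical
  obtain ⟨s, hs⟩ := TopologicalSpace.exists_dense_seq (Set.range ev)
  choose θs hθs using fun i => (s i).2
  have hdense : ∀ (θ : Θ) {ε : ℝ}, 0 < ε → ∃ i, |ev θ - ev (θs i)| < ε := by
    intro θ ε hε
    obtain ⟨i, hi⟩ := hs.exists_dist_lt ⟨ev θ, θ, rfl⟩ hε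
    exact ⟨i, by rwa [hθs, ← Real.dist_eq]⟩
  let Q : X → ℕ → ℕ → Prop := fun x k i => ∀ j, k ≤ j → j ≤ n → |T j x - ev (θs i)| < 2 * r j
  have hQ : ∀ j i, Measurable fun x => |T j x - ev (θs i)| < 2 * r j := fun j i =>
    measurableSet_setOfPred.1 (measurableSet_lt (((hT j).sub_const _).abs) measurable_const)
  have hex : ∀ x, ∃ k, 1 ≤ k ∧ ∃ i, Q x k i := fun x =>
    ⟨n + 1, by omega, 0, fun j h1 h2 => by omega⟩
  let K : X → ℕ := fun x => Nat.find (hex x)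
  have hK : Measurable K := by
    refine measurable_find hex fun k => measurableSet_setOfPred.2 ?_
    exact measurable_const.and (Measurable.exists fun i => Measurable.forall fun j =>
      measurable_const.imp (measurable_const.imp (hQ j i)))
  have hex2 : ∀ x, ∃ i, Q x (K x) i := fun x => (Nat.find_spec (hex x)).2
  let N : X → ℕ := fun x => Nat.find (hex2 x)
  have hN : Measurable N := by
    refine measurable_find hex2 fun i => measurableSet_setOfPred.2 ?_
    refine Measurable.forall fun j => Measurable.imp ?_ (measurable_const.imp (hQ j i))
    exact measurableSet_setOfPred.1 (measurableSet_le hK measurable_const)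
  refine ⟨fun x => θs (N x), measurable_from_nat.comp hN, fun x θ k hk hkn h => ?_⟩
  have hle : K x ≤ k := by
    refine Nat.find_min' (hex x) ⟨hk, ?_⟩
    -- finitely many radii are involved, so a dense sequence comes close enough to `ev θ`
    have hne : (Finset.Icc k n).Nonempty := ⟨k, Finset.mem_Icc.2 ⟨le_rfl, hkn⟩⟩
    have hpos : 0 < (Finset.Icc k n).inf' hne r :=
      (Finset.lt_inf'_iff _).2 fun j hj => hr j (hk.trans (Finset.mem_Icc.1 hj).1)
    obtain ⟨i, hi⟩ := hdense θ hpos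
    refine ⟨i, fun j h1 h2 => ?_⟩
    have h3 := hi.trans_le (Finset.inf'_le r (Finset.mem_Icc.2 ⟨h1, h2⟩))
    calc |T j x - ev (θs i)| ≤ |T j x - ev θ| + |ev θ - ev (θs i)| := abs_sub_le _ _ _
      _ < 2 * r j := by linarith [h j h1 h2]
  have h1 : |T k x - ev (θs (N x))| < 2 * r k := Nat.find_spec (hex2 x) k hle hkn
  have h2 := h k le_rfl hkn
  calc |ev (θs (N x)) - ev θ| ≤ |ev (θs (N x)) - T k x| + |T k x - ev θ| := abs_sub_le _ _ _
    _ ≤ 3 * r k := by rw [abs_sub_comm]; linarith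

/-! ### The upper bound -/

/-- The bandwidth for confidence level `e⁻ᵏ`, in units of `1 / θ`. -/
noncomputable def bandwidth (β : ℝ) (n k : ℕ) : ℝ := ((k : ℝ) / n) ^ (1 / (2 * β + 1))

theorem bandwidth_pos (β : ℝ) {n k : ℕ} (hn : 1 ≤ n) (hk : 1 ≤ k) : 0 < bandwidth β n k := by
  have h1 : (0 : ℝ) < n := by exact_mod_cast hn
  have h2 : (0 : ℝ) < k := by exact_mod_cast hk
  exact Real.rpow_pos_of_pos (by positivity) _

/-- The extrapolation of the empirical averages over intervals `(x₀, x₀ + (i + 1) h]` to `x₀`. -/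
noncomputable def averageEstimate (m : ℕ) (x₀ h : ℝ) {n : ℕ} (x : Fin n → ℝ) : ℝ :=
  ∑ i ∈ Finset.range (m + 1), extrapolationWeight m i *
    (((i + 1) * h)⁻¹ * (sampleCount (Set.Ioc x₀ (x₀ + (i + 1) * h)) x / n))

theorem measurable_averageEstimate (m : ℕ) (x₀ h : ℝ) {n : ℕ} :
    Measurable (averageEstimate m x₀ h : (Fin n → ℝ) → ℝ) :=
  Finset.measurable_sum _ fun _ _ =>
    (((measurable_sampleCount measurableSet_Ioc).div_const _).const_mul _).const_mul _

/-- The constant of the error of `averageEstimate`: a bias term and a deviation term. -/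
noncomputable def errorConst (β : ℝ) : ℝ :=
  2 ^ (⌈β⌉₊ - 1 + 1) * (((⌈β⌉₊ - 1 : ℕ) : ℝ) + 1) ^ β +
    2 ^ (⌈β⌉₊ - 1 + 1) * ((4 * (((⌈β⌉₊ - 1 : ℕ) : ℝ) + 1) + 1 + 1) *
      √(holderSup β * (((⌈β⌉₊ - 1 : ℕ) : ℝ) + 1)))

theorem errorConst_pos (β : ℝ) : 0 < errorConst β := by
  have := one_le_holderSup β
  unfold errorConst
  positivity

theorem IsHolderDensity.densityLaw_real_Ioc_le {β θ : ℝ} {f : ℝ → ℝ} (hβ : 0 < β) (hθ : 0 < θ)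
    (hf : IsHolderDensity β (θ ^ (β + 1)) f) (x : ℝ) {l : ℝ} (hl : 0 ≤ l) :
    (densityLaw f).real (Set.Ioc x (x + l)) ≤ holderSup β * θ * l := by
  rw [hf.densityLaw_real_Ioc (by linarith)]
  have h : ‖∫ y in x..x + l, f y‖ ≤ holderSup β * θ * |x + l - x| :=
    intervalIntegral.norm_integral_le_of_norm_le_const fun y _ => by
      rw [Real.norm_eq_abs, abs_of_nonneg (hf.nonneg y)]
      exact hf.le_holderSup hβ hθ y
  rw [add_sub_cancel_left, abs_of_nonneg hl] at h
  exact (le_abs_self _).trans h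

theorem averageEstimate_error {β θ : ℝ} {f : ℝ → ℝ} (hβ : 0 < β) (hθ : 0 < θ)
    (hf : IsHolderDensity β (θ ^ (β + 1)) f) (x₀ : ℝ) {n k : ℕ} (hk : 1 ≤ k) (hkn : k ≤ n) :
    (Measure.pi fun _ : Fin n => densityLaw f).real
      {x | errorConst β * θ * bandwidth β n k ^ β <
        |averageEstimate (⌈β⌉₊ - 1) x₀ (bandwidth β n k / θ) x - f x₀|} ≤
      1 / 2 * Real.exp (-k) := by
  have := hf.isProbabilityMeasure
  have hn : 1 ≤ n := hk.trans hkn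
  have hu : 0 < bandwidth β n k := bandwidth_pos β hn hk
  have hn0 : (0 : ℝ) < n := by exact_mod_cast hn
  have hk1 : (1 : ℝ) ≤ k := by exact_mod_cast hk
  have hkn' : (k : ℝ) / n ≤ 1 := by rw [div_le_one hn0]; exact_mod_cast hkn
  have hM := one_le_holderSup β
  have hbias := hf.abs_sub_sum_average_le hβ hθ hu x₀
  have hupow : bandwidth β n k ^ (2 * β + 1) = k / n := by
    rw [bandwidth, ← Real.rpow_mul (by positivity)]
    rw [one_div_mul_cancel (by positivity), Real.rpow_one]
  have hule : (k : ℝ) / n ≤ bandwidth β n k := by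
    rw [bandwidth]
    apply Real.self_le_rpow_of_le_one (by positivity) hkn'
    rw [div_le_one (by positivity)]; linarith
  set m := ⌈β⌉₊ - 1
  set u := bandwidth β n k
  set A : ℕ → Set ℝ := fun i => Set.Ioc x₀ (x₀ + (i + 1) * (u / θ))
  set V : ℝ := n * (holderSup β * (m + 1) * u)
  have hV : 0 < V := by positivity
  have hkV : (k : ℝ) ≤ V := by
    have h1 : (1 : ℝ) * 1 ≤ holderSup β * (m + 1) := by
      gcongr
      linarith [(Nat.cast_nonneg m : (0 : ℝ) ≤ m)]
    calc (k : ℝ) = n * (1 * 1 * (k / n)) := by field_simp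
      _ ≤ V := by simp only [V]; gcongr
  have hpV : ∀ i ∈ Finset.range (m + 1), n * (densityLaw f).real (A i) ≤ V := by
    intro i hi
    have hi' : (i : ℝ) ≤ m := by exact_mod_cast Nat.lt_succ_iff.1 (Finset.mem_range.1 hi)
    simp only [V]
    gcongr
    refine (hf.densityLaw_real_Ioc_le hβ hθ x₀ (by positivity)).trans ?_
    calc holderSup β * θ * ((i + 1) * (u / θ)) = holderSup β * (i + 1) * u := by field_simp
      _ ≤ _ := by gcongr
  set a : ℝ := 4 * ((m : ℝ) + 1) + 1
  have hsq : √(k * V) = n * √(holderSup β * (m + 1)) * (u ^ β * u) := by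
    have h1 : (k : ℝ) * V = (n * (u ^ β * u)) ^ 2 * (holderSup β * (m + 1)) := by
      have h2 : u ^ (2 * β + 1) = u ^ β * u ^ β * u := by
        rw [Real.rpow_add_one hu.ne', two_mul, Real.rpow_add hu]
      have h3 : (k : ℝ) = n * (u ^ β * u ^ β * u) := by rw [← h2, hupow]; field_simp
      rw [h3]; simp only [V]; ring
    rw [h1, Real.sqrt_mul (by positivity), Real.sqrt_sq (by positivity)]
    ring
  -- if all counts are within their deviation bounds, then so is the estimate
  have hsub : {x : Fin n → ℝ | errorConst β * θ * u ^ β <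
        |averageEstimate m x₀ (u / θ) x - f x₀|} ⊆
      ⋃ i ∈ Finset.range (m + 1), {x | (a + 1) * √(k * V) ≤
        |sampleCount (A i) x - n * (densityLaw f).real (A i)|} := by
    intro x hx
    by_contra hcon
    simp only [Set.mem_iUnion, not_exists, Set.mem_ofPred_eq, not_le] at hcon hx
    refine absurd hx (not_lt.2 ?_)
    have hdev : |averageEstimate m x₀ (u / θ) x - ∑ i ∈ Finset.range (m + 1),
        extrapolationWeight m i * (((i + 1) * (u / θ))⁻¹ * (densityLaw f).real (A i))| ≤
        2 ^ (m + 1) * ((a + 1) * √(holderSup β * (m + 1))) * (θ * u ^ β) := by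
      rw [averageEstimate, ← Finset.sum_sub_distrib]
      simp_rw [← mul_sub]
      refine (Finset.abs_sum_le_sum_abs _ _).trans ?_
      refine (Finset.sum_le_sum (g := fun i => |extrapolationWeight m i| *
        ((a + 1) * √(holderSup β * (m + 1)) * (θ * u ^ β))) fun i hi => ?_).trans ?_
      · rw [abs_mul, abs_mul, abs_of_nonneg (a := _⁻¹) (by positivity)]
        refine mul_le_mul_of_nonneg_left ?_ (abs_nonneg _)
        have h1 : |sampleCount (A i) x / n - (densityLaw f).real (A i)| ≤
            (a + 1) * √(k * V) / n := by
          rw [le_div_iff₀ hn0, ← abs_of_pos hn0, ← abs_mul, abs_of_pos hn0]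
          have : (sampleCount (A i) x / n - (densityLaw f).real (A i)) * n =
            sampleCount (A i) x - n * (densityLaw f).real (A i) := by field_simp
          rw [this]
          exact (hcon i hi).le
        have h2 : ((i + 1) * (u / θ))⁻¹ ≤ θ / u := by
          rw [mul_inv, inv_div]
          refine mul_le_of_le_one_left (by positivity) (inv_le_one_of_one_le₀ ?_)
          linarith [(Nat.cast_nonneg i : (0 : ℝ) ≤ i)]
        refine (mul_le_mul h2 h1 (abs_nonneg _) (by positivity)).trans_eq ?_
        rw [hsq]
        field_simp
      · rw [← Finset.sum_mul, mul_assoc (2 ^ (m + 1))]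
        gcongr
        exact sum_abs_extrapolationWeight_le m
    have htri := abs_sub_le (averageEstimate m x₀ (u / θ) x) (∑ i ∈ Finset.range (m + 1),
        extrapolationWeight m i * (((i + 1) * (u / θ))⁻¹ * (densityLaw f).real (A i))) (f x₀)
    rw [abs_sub_comm] at hbias
    have hE : errorConst β = 2 ^ (m + 1) * ((m : ℝ) + 1) ^ β +
      2 ^ (m + 1) * ((a + 1) * √(holderSup β * (m + 1))) := rfl
    rw [hE, mul_assoc, add_mul]
    linarith
  refine (measureReal_mono hsub (measure_ne_top _ _)).trans ((measureReal_biUnion_finset_le _ _).trans ?_)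
  refine (Finset.sum_le_sum (g := fun _ => 2 * Real.exp (-(a * k))) fun i hi =>
    measureReal_sqrt_le_abs_sampleCount_sub_le _ measurableSet_Ioc n hV (hpV i hi)
      (by positivity) hkV).trans ?_
  rw [Finset.sum_const, Finset.card_range, nsmul_eq_mul]
  -- `a` is so large that the `m + 1` terms sum to at most `e⁻ᵏ / 2`
  have h1 : 4 * ((m : ℝ) + 1) ≤ Real.exp (4 * ((m : ℝ) + 1) * k) := by
    have := Real.add_one_le_exp (4 * ((m : ℝ) + 1) * k)
    nlinarith [(Nat.cast_nonneg m : (0 : ℝ) ≤ m)]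
  have h2 : Real.exp (-k) = Real.exp (4 * ((m : ℝ) + 1) * k) * Real.exp (-(a * k)) := by
    rw [← Real.exp_add]
    congr 1
    simp only [a]; ring
  rw [h2]
  push_cast
  nlinarith [Real.exp_pos (-(a * k))]

theorem sum_half_exp_neg_le (k : ℕ) {N : ℕ} (h : k ≤ N) :
    ∑ j ∈ Finset.Ico k N, 1 / 2 * Real.exp (-(j : ℝ)) ≤ Real.exp (-k) - Real.exp (-N) := by
  induction N, h using Nat.le_induction with
  | base => simp
  | succ N hN ih =>
    rw [Finset.sum_Ico_succ_top hN]
    have h1 : Real.exp (-((N + 1 : ℕ) : ℝ)) = Real.exp (-N) * Real.exp (-1) := by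
      rw [← Real.exp_add]; push_cast; ring_nf
    have h2 : Real.exp (-1) ≤ 1 / 2 := by
      rw [Real.exp_neg, one_div]
      refine inv_anti₀ (by norm_num) ?_
      linarith [Real.add_one_le_exp (1 : ℝ)]
    rw [h1]
    nlinarith [Real.exp_pos (-(N : ℝ))]

theorem lossQuantile_le {X : Type*} [MeasurableSpace X] {P : Measure X} [IsFiniteMeasure P]
    {δ R : ℝ} {ℓ : X → ℝ} (hR : 0 ≤ R) (h : 1 - δ ≤ P.real {x | ℓ x ≤ R}) :
    lossQuantile δ P ℓ ≤ ENNReal.ofReal R := by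
  refine iInf₂_le (R.toNNReal) ?_
  rw [Real.coe_toNNReal R hR]
  exact ENNReal.ofReal_le_of_le_toReal h

/-- Rounding `t` up to an integer `k ≤ 2 t` costs at most a factor `2` in the rate. -/
theorem min_rpow_le_two_mul_min_rpow {p n t k : ℝ} (hp : 0 ≤ p) (hp1 : p ≤ 1) (hn : 0 < n)
    (ht : 0 ≤ t) (hk : 0 ≤ k) (hkt : k ≤ 2 * t) :
    min ((k / n) ^ p) 1 ≤ 2 * min ((t / n) ^ p) 1 := by
  rw [mul_min_of_nonneg _ _ zero_le_two]
  refine le_min ((min_le_left _ _).trans ?_) ((min_le_right _ _).trans (by norm_num))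
  calc (k / n) ^ p ≤ (2 * (t / n)) ^ p := by
        gcongr
        rw [← mul_div_assoc]
        gcongr
    _ = 2 ^ p * (t / n) ^ p := Real.mul_rpow (by norm_num) (by positivity)
    _ ≤ 2 ^ (1 : ℝ) * (t / n) ^ p := by
        gcongr
        norm_num
    _ = 2 * (t / n) ^ p := by rw [Real.rpow_one]

/-- There is an estimator, not depending on `δ`, that attains the rate at every level. -/
theorem exists_estimator {β θ : ℝ} (hβ : 0 < β) (hθ : 0 < θ) {n : ℕ} (hn : 1 ≤ n) (x₀ : ℝ)
    [Nonempty (HolderDensityAt β (θ ^ (β + 1)) x₀)] :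
    ∃ est : (Fin n → ℝ) → HolderDensityAt β (θ ^ (β + 1)) x₀, Measurable est ∧
      ∀ δ : ℝ, 0 < δ → δ ≤ 1 / 4 →
        worstCaseQuantile δ (iidModel β (θ ^ (β + 1)) x₀ n) (pointLoss β (θ ^ (β + 1)) x₀) est ≤
          ENNReal.ofReal ((18 * errorConst β ^ 2 + 2 * holderSup β ^ 2) *
            kdeRate β (θ ^ (β + 1)) n δ) := by
  have hn0 : (0 : ℝ) < n := by exact_mod_cast hn
  obtain ⟨est, hest, hsel⟩ := exists_measurable_selection
    (fun f : HolderDensityAt β (θ ^ (β + 1)) x₀ => f.1 x₀) n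
    (T := fun k x => averageEstimate (⌈β⌉₊ - 1) x₀ (bandwidth β n k / θ) (x : Fin n → ℝ))
    (fun k => measurable_averageEstimate _ _ _)
    (r := fun k => errorConst β * θ * bandwidth β n k ^ β)
    (fun k hk => mul_pos (mul_pos (errorConst_pos β) hθ)
      (Real.rpow_pos_of_pos (bandwidth_pos β hn hk) _))
  refine ⟨est, hest, fun δ hδ hδ4 => ?_⟩
  refine iSup_le fun f => iSup₂_le fun P hP => ?_
  rw [iidModel, Set.mem_singleton_iff] at hP
  subst hP
  have hf : IsHolderDensity β (θ ^ (β + 1)) f.1 := f.2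
  have := hf.isProbabilityMeasure
  set L := Real.log (1 / δ) with hL
  have hL1 : 1 ≤ L := by
    rw [hL, Real.le_log_iff_exp_le (by positivity)]
    have h1 := Real.exp_one_lt_d9
    have h2 : 4 ≤ 1 / δ := by rw [le_div_iff₀ hδ]; linarith
    linarith
  set k := ⌈L⌉₊ with hk
  have hLk : L ≤ k := Nat.le_ceil L
  have hkL : (k : ℝ) ≤ 2 * L := by linarith [Nat.ceil_lt_add_one (zero_le_one.trans hL1)]
  have hk1 : 1 ≤ k := Nat.one_le_ceil_iff.2 (zero_lt_one.trans_le hL1)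
  set p := 2 * β / (2 * β + 1) with hp
  have hp0 : 0 ≤ p := by positivity
  have hp1 : p ≤ 1 := by rw [hp, div_le_one (by positivity)]; linarith
  have hmin := min_rpow_le_two_mul_min_rpow hp0 hp1 hn0 (zero_le_one.trans hL1)
    (Nat.cast_nonneg k) hkL
  have hrate : kdeRate β (θ ^ (β + 1)) n δ = θ ^ 2 * min ((L / n) ^ p) 1 := by
    rw [kdeRate, ← Real.rpow_mul hθ.le, mul_div_cancel₀ _ (by positivity)]
    norm_num [hL, hp]
  rw [hrate]
  set ρ := min ((L / n) ^ p) 1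
  rcases le_or_gt k n with hkn | hkn
  · have hkn1 : (k : ℝ) / n ≤ 1 := by rw [div_le_one hn0]; exact_mod_cast hkn
    have hkr : ((k : ℝ) / n) ^ p ≤ 2 * ρ := by
      rwa [min_eq_left (Real.rpow_le_one (by positivity) hkn1 hp0)] at hmin
    have hbw : (bandwidth β n k ^ β) ^ 2 = ((k : ℝ) / n) ^ p := by
      rw [bandwidth, ← Real.rpow_mul (by positivity), ← Real.rpow_natCast,
        ← Real.rpow_mul (by positivity)]
      congr 1
      rw [hp]; push_cast; ring
    refine (lossQuantile_le (R := (3 * (errorConst β * θ * bandwidth β n k ^ β)) ^ 2)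
      (sq_nonneg _) ?_).trans (ENNReal.ofReal_le_ofReal ?_)
    · set B : Set (Fin n → ℝ) := ⋃ j ∈ Finset.Ico k (n + 1),
        {x | errorConst β * θ * bandwidth β n j ^ β <
          |averageEstimate (⌈β⌉₊ - 1) x₀ (bandwidth β n j / θ) x - f.1 x₀|} with hB
      have hBm : MeasurableSet B := Finset.measurableSet_biUnion _ fun j _ =>
        measurableSet_lt measurable_const ((measurable_averageEstimate _ _ _).sub_const _).abs
      have hBδ : (Measure.pi fun _ : Fin n => densityLaw f.1).real B ≤ δ := by
        refine (measureReal_biUnion_finset_le _ _).trans ?_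
        refine (Finset.sum_le_sum (g := fun j : ℕ => 1 / 2 * Real.exp (-(j : ℝ)))
          fun j hj => ?_).trans ?_
        · rw [Finset.mem_Ico] at hj
          exact averageEstimate_error hβ hθ hf x₀ (hk1.trans hj.1) (by omega)
        · have h1 := sum_half_exp_neg_le k (N := n + 1) (by omega)
          have h2 : Real.exp (-(k : ℝ)) ≤ δ := by
            rw [← Real.le_log_iff_exp_le hδ]
            rw [hL, one_div, Real.log_inv] at hLk
            linarith
          linarith [Real.exp_pos (-((n + 1 : ℕ) : ℝ))]
      have hcompl := probReal_compl_eq_one_sub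
        (μ := Measure.pi fun _ : Fin n => densityLaw f.1) hBm
      refine le_trans (by rw [hcompl]; linarith) (measureReal_mono (s₁ := Bᶜ) fun x hx => ?_)
      simp only [hB, Set.mem_compl_iff, Set.mem_iUnion, not_exists, Set.mem_ofPred_eq,
        not_lt, Finset.mem_Ico] at hx
      have h3 := hsel x f k hk1 hkn fun j h1 h2 => hx j ⟨h1, by omega⟩
      rw [Set.mem_ofPred_eq, pointLoss, ← sq_abs]
      gcongr
    · have h1 : (3 * (errorConst β * θ * bandwidth β n k ^ β)) ^ 2 =
          9 * errorConst β ^ 2 * θ ^ 2 * ((k : ℝ) / n) ^ p := by rw [← hbw]; ring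
      rw [h1]
      have h2 : 9 * errorConst β ^ 2 * θ ^ 2 * ((k : ℝ) / n) ^ p ≤
        9 * errorConst β ^ 2 * θ ^ 2 * (2 * ρ) := by gcongr
      have h3 : 0 ≤ ρ := by positivity
      have h4 : 0 ≤ 2 * holderSup β ^ 2 * (θ ^ 2 * ρ) := by positivity
      linarith
  · -- beyond the largest level the trivial bound on the loss suffices
    have hkr : 1 ≤ 2 * ρ := by
      rwa [min_eq_right] at hmin
      refine Real.one_le_rpow ?_ hp0
      rw [le_div_iff₀ hn0, one_mul]
      exact_mod_cast hkn.le
    refine (lossQuantile_le (R := (holderSup β * θ) ^ 2)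
      (sq_nonneg _) ?_).trans (ENNReal.ofReal_le_ofReal ?_)
    · have : {x | pointLoss β (θ ^ (β + 1)) x₀ (est x) f ≤ (holderSup β * θ) ^ 2} = Set.univ := by
        refine Set.eq_univ_of_forall fun x => ?_
        have hg : IsHolderDensity β (θ ^ (β + 1)) (est x).1 := (est x).2
        rw [Set.mem_ofPred_eq, pointLoss, ← sq_abs]
        gcongr
        rw [abs_le]
        constructor <;> linarith [hf.nonneg x₀, hg.nonneg x₀, hf.le_holderSup hβ hθ x₀,
          hg.le_holderSup hβ hθ x₀]
      rw [this, probReal_univ]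
      linarith
    · have h4 : 0 ≤ 18 * errorConst β ^ 2 * (θ ^ 2 * ρ) := by positivity
      have h5 : (holderSup β * θ) ^ 2 * 1 ≤ (holderSup β * θ) ^ 2 * (2 * ρ) := by gcongr
      linarith

/-! ### Two Hölder densities that are hard to tell apart -/

/-- A smooth bump on the real line, equal to `1` on `[-1, 1]` and vanishing off `(-2, 2)`. -/
noncomputable def unitBump : ContDiffBump (0 : ℝ) := ⟨1, 2, one_pos, one_lt_two⟩

theorem unitBump_eq_one {x : ℝ} (hx : |x| ≤ 1) : unitBump x = 1 :=
  unitBump.one_of_mem_closedBall (by simpa [unitBump] using hx)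

theorem unitBump_eq_zero {x : ℝ} (hx : 2 ≤ |x|) : unitBump x = 0 :=
  unitBump.zero_of_le_dist (by simpa [unitBump] using hx)

theorem exists_bound_iteratedDeriv_unitBump {β : ℝ} (hβ : 0 < β) :
    ∃ B : ℝ, 0 < B ∧ ∀ x y, |iteratedDeriv (⌈β⌉₊ - 1) unitBump x -
      iteratedDeriv (⌈β⌉₊ - 1) unitBump y| ≤ B * |x - y| ^ (β - ((⌈β⌉₊ - 1 : ℕ) : ℝ)) := by
  have hα := holder_exponent_pos hβ
  have hα1 := holder_exponent_le_one hβ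
  set m := ⌈β⌉₊ - 1
  have hcs : ∀ k, HasCompactSupport (iteratedDeriv k unitBump) := by
    intro k
    induction k with
    | zero => simpa using unitBump.hasCompactSupport
    | succ k ih => rw [iteratedDeriv_succ]; exact ih.deriv
  have hcd : ContDiff ℝ 1 (iteratedDeriv m unitBump) := by
    rw [contDiff_one_iff_deriv, ← iteratedDeriv_succ]
    have h : ContDiff ℝ ((m + 1 : ℕ) : WithTop ℕ∞) unitBump :=
      unitBump.contDiff (n := ((m + 1 : ℕ) : ℕ∞))
    exact ⟨h.differentiable_iteratedDeriv m (by exact_mod_cast m.lt_succ_self),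
      h.continuous_iteratedDeriv (m + 1) le_rfl⟩
  obtain ⟨C, hC⟩ := hcd.lipschitzWith_of_hasCompactSupport (hcs m) one_ne_zero
  obtain ⟨D, hD⟩ := (hcs m).exists_bound_of_continuous hcd.continuous
  have hD0 : 0 ≤ D := (norm_nonneg _).trans (hD 0)
  refine ⟨C + 2 * D + 1, by positivity, fun x y => ?_⟩
  -- the Lipschitz bound is used at small distances and the sup bound at large ones
  rcases le_or_gt |x - y| 1 with h | h
  · have h1 := hC.dist_le_mul x y
    rw [Real.dist_eq, Real.dist_eq] at h1
    have h2 : |x - y| ≤ |x - y| ^ (β - (m : ℝ)) :=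
      Real.self_le_rpow_of_le_one (abs_nonneg _) h hα1
    refine h1.trans (mul_le_mul ?_ h2 (abs_nonneg _) (by positivity))
    linarith
  · have h1 : |iteratedDeriv m unitBump x - iteratedDeriv m unitBump y| ≤ 2 * D := by
      have hx := hD x
      have hy := hD y
      rw [Real.norm_eq_abs, abs_le] at hx hy
      rw [abs_le]
      constructor <;> linarith
    have h2 : 1 ≤ |x - y| ^ (β - (m : ℝ)) := Real.one_le_rpow h.le hα.le
    nlinarith [C.coe_nonneg]

/-- The bump of height `p` centred at `x₀`, at scale `1 / q`. -/
noncomputable def scaledBump (p q x₀ x : ℝ) : ℝ := p * unitBump (q * (x - x₀))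

theorem contDiff_scaledBump (p q x₀ : ℝ) (n : ℕ) : ContDiff ℝ n (scaledBump p q x₀) := by
  have h : ContDiff ℝ n unitBump := unitBump.contDiff (n := (n : ℕ∞))
  exact contDiff_const.mul (h.comp (contDiff_const.mul (contDiff_id.sub contDiff_const)))

theorem continuous_scaledBump (p q x₀ : ℝ) : Continuous (scaledBump p q x₀) :=
  (contDiff_scaledBump p q x₀ 0).continuous

theorem iteratedDeriv_scaledBump (p q x₀ : ℝ) (n : ℕ) (x : ℝ) :
    iteratedDeriv n (scaledBump p q x₀) x =
      p * (q ^ n * iteratedDeriv n unitBump (q * (x - x₀))) := by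
  have h : ContDiff ℝ n unitBump := unitBump.contDiff (n := (n : ℕ∞))
  have h1 : scaledBump p q x₀ = fun x => p * (fun z => unitBump (q * z)) (x - x₀) := rfl
  rw [h1, iteratedDeriv_const_mul_field,
    iteratedDeriv_comp_sub_const n (fun z => unitBump (q * z)) x₀, iteratedDeriv_comp_const_mul h]

theorem holder_scaledBump {β B : ℝ} (hB : ∀ x y, |iteratedDeriv (⌈β⌉₊ - 1) unitBump x -
      iteratedDeriv (⌈β⌉₊ - 1) unitBump y| ≤ B * |x - y| ^ (β - ((⌈β⌉₊ - 1 : ℕ) : ℝ)))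
    {p q : ℝ} (hp : 0 ≤ p) (hq : 0 < q) (x₀ x y : ℝ) :
    |iteratedDeriv (⌈β⌉₊ - 1) (scaledBump p q x₀) x -
      iteratedDeriv (⌈β⌉₊ - 1) (scaledBump p q x₀) y| ≤
      p * q ^ β * B * |x - y| ^ (β - ((⌈β⌉₊ - 1 : ℕ) : ℝ)) := by
  rw [iteratedDeriv_scaledBump, iteratedDeriv_scaledBump, ← mul_sub, ← mul_sub, abs_mul, abs_mul,
    abs_of_nonneg hp, abs_of_nonneg (pow_nonneg hq.le _)]
  have h := hB (q * (x - x₀)) (q * (y - x₀))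
  rw [← mul_sub, sub_sub_sub_cancel_right, abs_mul, abs_of_pos hq,
    Real.mul_rpow hq.le (abs_nonneg _)] at h
  have h1 : q ^ β = q ^ (⌈β⌉₊ - 1) * q ^ (β - ((⌈β⌉₊ - 1 : ℕ) : ℝ)) := by
    rw [← Real.rpow_natCast q, ← Real.rpow_add hq]
    ring_nf
  calc p * (q ^ (⌈β⌉₊ - 1) * _) ≤ p * (q ^ (⌈β⌉₊ - 1) *
        (B * (q ^ (β - ((⌈β⌉₊ - 1 : ℕ) : ℝ)) * |x - y| ^ (β - ((⌈β⌉₊ - 1 : ℕ) : ℝ))))) := by gcongr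
    _ = _ := by rw [h1]; ring

theorem integral_scaledBump (p x₀ : ℝ) {q : ℝ} (hq : 0 < q) :
    ∫ x, scaledBump p q x₀ x = p / q * ∫ x, unitBump x := by
  simp only [scaledBump]
  rw [integral_const_mul, integral_sub_right_eq_self (fun z => unitBump (q * z)) x₀,
    Measure.integral_comp_mul_left unitBump q, abs_of_pos (inv_pos.2 hq), smul_eq_mul]
  ring

theorem integrable_scaledBump (p x₀ : ℝ) {q : ℝ} (hq : 0 < q) :
    Integrable (scaledBump p q x₀) :=
  (((unitBump.integrable (μ := volume)).comp_mul_left' hq.ne').comp_sub_right x₀).const_mul p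

theorem scaledBump_nonneg {p : ℝ} (hp : 0 ≤ p) (q x₀ x : ℝ) : 0 ≤ scaledBump p q x₀ x :=
  mul_nonneg hp unitBump.nonneg

theorem scaledBump_le {p : ℝ} (hp : 0 ≤ p) (q x₀ x : ℝ) : scaledBump p q x₀ x ≤ p :=
  mul_le_of_le_one_right hp unitBump.le_one

/-- A second-order lower bound for the geometric mean of `κ` and `κ + z`. -/
theorem le_sqrt_mul_add {κ z : ℝ} (hκ : 0 < κ) (hz : |z| ≤ κ) :
    κ + z / 2 - z ^ 2 / (2 * κ) ≤ √(κ * (κ + z)) := by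
  refine (le_abs_self _).trans (Real.abs_le_sqrt ?_)
  obtain ⟨w, rfl⟩ : ∃ w, z = κ * w := ⟨z / κ, by field_simp⟩
  rw [abs_mul, abs_of_pos hκ] at hz
  have hw : |w| ≤ 1 := by
    by_contra h
    nlinarith [not_le.1 h]
  obtain ⟨h1, h2⟩ := abs_le.1 hw
  have e1 : κ + κ * w / 2 - (κ * w) ^ 2 / (2 * κ) = κ * (1 + w / 2 - w ^ 2 / 2) := by
    field_simp
  rw [e1, mul_pow, show κ * (κ + κ * w) = κ ^ 2 * (1 + w) by ring]
  refine mul_le_mul_of_nonneg_left ?_ (sq_nonneg κ)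
  have h3 : (1 - w) ^ 2 ≤ 4 := by nlinarith
  nlinarith [mul_nonneg (sq_nonneg w) (sub_nonneg.2 h3)]

/-- The two hypotheses of the lower bound: a density that is flat on a neighbourhood of `x₀`, and
its perturbation there by a localised function of width `h / θ` and vanishing integral. Their
values at `x₀` differ by `s θ h ^ β`, while their affinity is within `h ^ (2β + 1) / 32`
of `1`. -/
theorem exists_close_holderDensities {β : ℝ} (hβ : 0 < β) :
    ∃ s : ℝ, 0 < s ∧ ∀ θ : ℝ, 0 < θ → ∀ x₀ h : ℝ, 0 < h → h ≤ 1 → ∃ f₀ f₁ : ℝ → ℝ,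
      IsHolderDensity β (θ ^ (β + 1)) f₀ ∧ IsHolderDensity β (θ ^ (β + 1)) f₁ ∧
      f₁ x₀ - f₀ x₀ = s * θ * h ^ β ∧
      1 - h ^ (2 * β + 1) / 32 ≤ ∫ x, √(f₀ x * f₁ x) := by
  obtain ⟨B, hB, hBd⟩ := exists_bound_iteratedDeriv_unitBump hβ
  set I := ∫ x, unitBump x with hI
  have hI0 : 0 < I := unitBump.integral_pos
  obtain ⟨a, ha, ha2, haB⟩ : ∃ a : ℝ, 0 < a ∧ a ≤ 1 / 2 ∧ a * (B / I) ≤ 1 / 2 := by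
    refine ⟨min (1 / 2) (I / (2 * B)), by positivity, min_le_left _ _, ?_⟩
    calc min (1 / 2) (I / (2 * B)) * (B / I) ≤ I / (2 * B) * (B / I) := by
          gcongr; exact min_le_right _ _
      _ = 1 / 2 := by field_simp
  obtain ⟨s, hs, hsB, hs1, hsa⟩ : ∃ s : ℝ, 0 < s ∧ s * ((2 * 2 ^ β + 1) * B) ≤ 1 / 2 ∧
      s ≤ 1 / 16 ∧ s ≤ a / I / 16 := by
    have hK : 0 < (2 * (2 : ℝ) ^ β + 1) * B := by positivity
    refine ⟨min (1 / (2 * ((2 * 2 ^ β + 1) * B))) (min (1 / 16) (a / I / 16)), by positivity,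
      ?_, (min_le_right _ _).trans (min_le_left _ _), (min_le_right _ _).trans (min_le_right _ _)⟩
    calc _ ≤ 1 / (2 * ((2 * (2 : ℝ) ^ β + 1) * B)) * ((2 * 2 ^ β + 1) * B) := by
          gcongr; exact min_le_left _ _
      _ = 1 / 2 := by field_simp
  refine ⟨s, hs, fun θ hθ x₀ h hh hh1 => ?_⟩
  have hhβ : 0 < h ^ β := Real.rpow_pos_of_pos hh _
  have hhβ1 : h ^ β ≤ 1 := Real.rpow_le_one hh.le hh1 hβ.le
  have hθβ : 0 < θ ^ (β + 1) := Real.rpow_pos_of_pos hθ _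
  set κ := θ * a / I with hκ
  have hκ0 : 0 < κ := by positivity
  set b := s * θ * h ^ β with hb
  have hb0 : 0 < b := by positivity
  have hbκ : 2 * b ≤ κ := by
    calc 2 * b = 2 * (s * θ * h ^ β) := rfl
      _ ≤ 2 * (a / I / 16 * θ * 1) := by gcongr
      _ = κ / 8 := by rw [hκ]; ring
      _ ≤ κ := by linarith
  set f₀ := scaledBump κ (θ * a) x₀ with hf₀
  set g₁ := scaledBump (2 * b) (2 * (θ / h)) x₀ with hg₁
  set g₂ := scaledBump b (θ / h) x₀ with hg₂
  have hq0 : 0 < θ * a := by positivity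
  have hq2 : 0 < θ / h := by positivity
  have hq1 : 0 < 2 * (θ / h) := by positivity
  -- the perturbation is supported where `f₀` is constant
  have hfar : ∀ x, 2 * h / θ ≤ |x - x₀| → g₁ x = 0 ∧ g₂ x = 0 := by
    intro x hx
    have h1 : 2 ≤ θ / h * |x - x₀| := by
      calc (2 : ℝ) = θ / h * (2 * h / θ) := by field_simp
        _ ≤ _ := by gcongr
    constructor
    · rw [hg₁, scaledBump, unitBump_eq_zero, mul_zero]
      rw [abs_mul, abs_of_pos hq1]; nlinarith
    · rw [hg₂, scaledBump, unitBump_eq_zero, mul_zero]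
      rwa [abs_mul, abs_of_pos hq2]
  have hnear : ∀ x, |x - x₀| ≤ 2 * h / θ → f₀ x = κ := by
    intro x hx
    rw [hf₀, scaledBump, unitBump_eq_one, mul_one]
    rw [abs_mul, abs_of_pos hq0]
    calc θ * a * |x - x₀| ≤ θ * (1 / 2) * (2 * 1 / θ) := by gcongr; exact hx.trans (by gcongr)
      _ = 1 := by field_simp
  have hg_abs : ∀ x, |g₁ x - g₂ x| ≤ 2 * b := by
    intro x
    have h1 := scaledBump_nonneg (by positivity : 0 ≤ 2 * b) (2 * (θ / h)) x₀ x
    have h2 := scaledBump_le (by positivity : 0 ≤ 2 * b) (2 * (θ / h)) x₀ x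
    have h3 := scaledBump_nonneg hb0.le (θ / h) x₀ x
    have h4 := scaledBump_le hb0.le (θ / h) x₀ x
    rw [abs_le]
    constructor <;> linarith
  have hf₀n : ∀ x, 0 ≤ f₀ x := scaledBump_nonneg hκ0.le _ _
  have hf₁n : ∀ x, 0 ≤ f₀ x + (g₁ x - g₂ x) := by
    intro x
    rcases le_or_gt |x - x₀| (2 * h / θ) with hx | hx
    · rw [hnear x hx]
      linarith [(abs_le.1 (hg_abs x)).1]
    · rw [(hfar x hx.le).1, (hfar x hx.le).2]
      simpa using hf₀n x
  have hi₀ : Integrable f₀ := integrable_scaledBump _ _ hq0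
  have hi₁ : Integrable g₁ := integrable_scaledBump _ _ hq1
  have hi₂ : Integrable g₂ := integrable_scaledBump _ _ hq2
  have hig : Integrable fun x => g₁ x - g₂ x := hi₁.sub hi₂
  have hig2 : Integrable fun x => (g₁ x - g₂ x) / 2 := hig.div_const 2
  have hsum : Integrable fun x => f₀ x + (g₁ x - g₂ x) / 2 := hi₀.add hig2
  have hint₀ : ∫ x, f₀ x = 1 := by
    rw [hf₀, integral_scaledBump _ _ hq0, ← hI, hκ]
    field_simp
  have hintg : ∫ x, (g₁ x - g₂ x) = 0 := by
    rw [integral_sub hi₁ hi₂, hg₁, hg₂, integral_scaledBump _ _ hq1, integral_scaledBump _ _ hq2]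
    field_simp
    ring
  have hint₁ : ∫ x, (f₀ x + (g₁ x - g₂ x)) = 1 := by
    rw [integral_add hi₀ hig, hint₀, hintg, add_zero]
  have hH₀ : ∀ x y, |iteratedDeriv (⌈β⌉₊ - 1) f₀ x - iteratedDeriv (⌈β⌉₊ - 1) f₀ y| ≤
      θ ^ (β + 1) / 2 * |x - y| ^ (β - ((⌈β⌉₊ - 1 : ℕ) : ℝ)) := by
    intro x y
    refine (holder_scaledBump hBd hκ0.le hq0 x₀ x y).trans ?_
    gcongr
    have h1 : a ^ β ≤ 1 := Real.rpow_le_one ha.le (by linarith) hβ.le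
    rw [Real.mul_rpow hθ.le ha.le, Real.rpow_add_one hθ.ne', hκ]
    calc θ * a / I * (θ ^ β * a ^ β) * B = θ ^ β * θ * (a * (B / I) * a ^ β) := by ring
      _ ≤ θ ^ β * θ * (1 / 2 * 1) := by gcongr
      _ = _ := by ring
  have hHg : ∀ x y, |iteratedDeriv (⌈β⌉₊ - 1) g₁ x - iteratedDeriv (⌈β⌉₊ - 1) g₁ y| +
      |iteratedDeriv (⌈β⌉₊ - 1) g₂ x - iteratedDeriv (⌈β⌉₊ - 1) g₂ y| ≤
      θ ^ (β + 1) / 2 * |x - y| ^ (β - ((⌈β⌉₊ - 1 : ℕ) : ℝ)) := by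
    intro x y
    refine (add_le_add (holder_scaledBump hBd (by positivity) hq1 x₀ x y)
      (holder_scaledBump hBd hb0.le hq2 x₀ x y)).trans ?_
    rw [← add_mul]
    gcongr
    rw [Real.mul_rpow zero_le_two hq2.le, Real.div_rpow hθ.le hh.le, Real.rpow_add_one hθ.ne', hb]
    calc 2 * (s * θ * h ^ β) * (2 ^ β * (θ ^ β / h ^ β)) * B +
          s * θ * h ^ β * (θ ^ β / h ^ β) * B
        = θ ^ β * θ * (s * ((2 * 2 ^ β + 1) * B)) := by field_simp
      _ ≤ θ ^ β * θ * (1 / 2) := by gcongr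
      _ = _ := by ring
  have hcd₁ : ContDiff ℝ ((⌈β⌉₊ - 1 : ℕ) : WithTop ℕ∞) (fun x => f₀ x + (g₁ x - g₂ x)) :=
    (contDiff_scaledBump _ _ _ _).add ((contDiff_scaledBump _ _ _ _).sub
      (contDiff_scaledBump _ _ _ _))
  have hc₀ : Continuous f₀ := continuous_scaledBump _ _ _
  have hc₁ : Continuous fun x => f₀ x + (g₁ x - g₂ x) :=
    hc₀.add ((continuous_scaledBump _ _ _).sub (continuous_scaledBump _ _ _))
  refine ⟨f₀, fun x => f₀ x + (g₁ x - g₂ x), ⟨hc₀.measurable, hf₀n, hint₀, fun k hk => ?_,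
    fun x y => (hH₀ x y).trans ?_⟩, ⟨hc₁.measurable, hf₁n, hint₁, fun k hk => ?_,
    fun x y => ?_⟩, ?_, ?_⟩
  · exact (contDiff_scaledBump _ _ _ (⌈β⌉₊ - 1)).differentiable_iteratedDeriv k
      (by exact_mod_cast hk)
  · gcongr
    linarith
  · exact hcd₁.differentiable_iteratedDeriv k (by exact_mod_cast hk)
  · have hD : ∀ z, iteratedDeriv (⌈β⌉₊ - 1) (fun x => f₀ x + (g₁ x - g₂ x)) z =
        iteratedDeriv (⌈β⌉₊ - 1) f₀ z +
          (iteratedDeriv (⌈β⌉₊ - 1) g₁ z - iteratedDeriv (⌈β⌉₊ - 1) g₂ z) := by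
      intro z
      rw [iteratedDeriv_fun_add (contDiff_scaledBump _ _ _ _).contDiffAt
        ((contDiff_scaledBump _ _ _ _).sub (contDiff_scaledBump _ _ _ _)).contDiffAt,
        iteratedDeriv_fun_sub (contDiff_scaledBump _ _ _ _).contDiffAt
        (contDiff_scaledBump _ _ _ _).contDiffAt]
    rw [hD, hD]
    have e : ∀ A A' C C' D D' : ℝ, A + (C - D) - (A' + (C' - D')) =
      (A - A') + ((C - C') - (D - D')) := by intros; ring
    rw [e]
    refine (abs_add_le _ _).trans ((add_le_add (hH₀ x y) ((abs_sub _ _).trans (hHg x y))).trans_eq ?_)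
    ring
  · have h1 : unitBump 0 = 1 := unitBump_eq_one (by simp)
    simp only [hg₁, hg₂, scaledBump, sub_self, mul_zero, h1]
    ring
  · set J := Set.Icc (x₀ - 2 * h / θ) (x₀ + 2 * h / θ) with hJ
    set D := (2 * b) ^ 2 / (2 * κ) with hD
    have hlow : ∀ x, f₀ x + (g₁ x - g₂ x) / 2 - J.indicator (fun _ => D) x ≤
        √(f₀ x * (f₀ x + (g₁ x - g₂ x))) := by
      intro x
      by_cases hx : x ∈ J
      · have hx' : |x - x₀| ≤ 2 * h / θ := by
          rw [abs_le]; constructor <;> linarith [hx.1, hx.2]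
        rw [Set.indicator_of_mem hx, hnear x hx']
        refine le_trans ?_ (le_sqrt_mul_add hκ0 ((hg_abs x).trans hbκ))
        have : (g₁ x - g₂ x) ^ 2 / (2 * κ) ≤ D := by
          rw [hD, ← sq_abs (g₁ x - g₂ x)]
          gcongr
          exact hg_abs x
        linarith
      · have hx' : 2 * h / θ ≤ |x - x₀| := by
          by_contra hcon
          rw [not_le, abs_lt] at hcon
          exact hx ⟨by linarith, by linarith⟩
        rw [Set.indicator_of_notMem hx, (hfar x hx').1, (hfar x hx').2]
        simp [Real.sqrt_mul_self (hf₀n x)]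
    have hiJ : Integrable (J.indicator fun _ => D) :=
      (integrable_indicator_iff measurableSet_Icc).2 (integrableOn_const (by simp))
    have hlow_int : ∫ x, (f₀ x + (g₁ x - g₂ x) / 2 - J.indicator (fun _ => D) x) =
        1 - 4 * h / θ * D := by
      rw [integral_sub hsum hiJ, integral_add hi₀ hig2, hint₀, integral_div, hintg,
        integral_indicator_const _ measurableSet_Icc, Real.volume_real_Icc_of_le
          (by linarith [show 0 < 2 * h / θ by positivity]), smul_eq_mul]
      ring
    have hsqrt_int : Integrable fun x => √(f₀ x * (f₀ x + (g₁ x - g₂ x))) := by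
      refine Integrable.mono' (hi₀.add (hi₀.add hig))
        (Real.continuous_sqrt.comp (hc₀.mul hc₁)).aestronglyMeasurable
        (Filter.Eventually.of_forall fun x => ?_)
      rw [Real.norm_eq_abs, abs_of_nonneg (Real.sqrt_nonneg _)]
      refine Real.sqrt_le_iff.2 ⟨add_nonneg (hf₀n x) (hf₁n x), ?_⟩
      simp only [Pi.add_apply]
      nlinarith [hf₀n x, hf₁n x, sq_nonneg (f₀ x), sq_nonneg (f₀ x + (g₁ x - g₂ x)),
        mul_nonneg (hf₀n x) (hf₁n x)]
    refine le_trans ?_ (integral_mono (hsum.sub hiJ) hsqrt_int hlow)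
    simp only [Pi.sub_apply]
    rw [hlow_int]
    have h1 : 4 * h / θ * D = 8 * (s * (s * (I / a))) * (h ^ β * h ^ β * h) := by
      rw [hD, hb, hκ]
      field_simp
      ring
    have h2 : h ^ (2 * β + 1) = h ^ β * h ^ β * h := by
      rw [Real.rpow_add_one hh.ne', two_mul, Real.rpow_add hh]
    have h3 : s * (I / a) ≤ 1 / 16 := by
      calc s * (I / a) ≤ a / I / 16 * (I / a) := by gcongr
        _ = 1 / 16 := by field_simp
    have h4 : 8 * (s * (s * (I / a))) * (h ^ β * h ^ β * h) ≤
        8 * (1 / 16 * (1 / 16)) * (h ^ β * h ^ β * h) := by gcongr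
    rw [h1, h2]
    linarith

/-! ### Testing two product densities -/

theorem integral_sqrt_mul_le {Ω : Type*} [MeasurableSpace Ω] {μ : Measure Ω} {F G : Ω → ℝ}
    (hF : Integrable F μ) (hG : Integrable G μ) (hF0 : ∀ x, 0 ≤ F x) (hG0 : ∀ x, 0 ≤ G x)
    {t : ℝ} (ht : 0 < t) :
    ∫ x, √(F x * G x) ∂μ ≤ (t * ∫ x, F x ∂μ + t⁻¹ * ∫ x, G x ∂μ) / 2 := by
  rw [← integral_const_mul, ← integral_const_mul,
    ← integral_add (hF.const_mul t) (hG.const_mul t⁻¹), ← integral_div]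
  refine integral_mono_of_nonneg (Filter.Eventually.of_forall fun x => Real.sqrt_nonneg _)
    (((hF.const_mul t).add (hG.const_mul t⁻¹)).div_const 2)
    (Filter.Eventually.of_forall fun x => ?_)
  have h1 := hF0 x
  have h2 := hG0 x
  refine Real.sqrt_le_iff.2 ⟨by positivity, ?_⟩
  have h3 : F x * G x = (t * F x) * (t⁻¹ * G x) := by field_simp
  rw [h3]
  nlinarith [sq_nonneg (t * F x - t⁻¹ * G x)]

/-- If some event has probability at least `1 - δ` under the density `F` and at most `δ` under the
density `G`, then the affinity of `F` and `G` is at most `√δ (2 - δ)`. -/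
theorem affinity_le_of_test {Ω : Type*} [MeasurableSpace Ω] {μ : Measure Ω} {F G : Ω → ℝ}
    (hF : Integrable F μ) (hG : Integrable G μ) (hF0 : ∀ x, 0 ≤ F x) (hG0 : ∀ x, 0 ≤ G x)
    (hF1 : ∫ x, F x ∂μ = 1) (hG1 : ∫ x, G x ∂μ = 1) {A : Set Ω} (hA : MeasurableSet A) {δ : ℝ}
    (hδ : 0 < δ) (hδ1 : δ ≤ 1) (hFA : 1 - δ ≤ ∫ x in A, F x ∂μ) (hGA : ∫ x in A, G x ∂μ ≤ δ) :
    ∫ x, √(F x * G x) ∂μ ≤ √δ * (2 - δ) := by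
  have hint : Integrable (fun x => √(F x * G x)) μ := by
    refine Integrable.mono' (hF.add hG)
      (Real.continuous_sqrt.comp_aestronglyMeasurable (hF.1.mul hG.1))
      (Filter.Eventually.of_forall fun x => ?_)
    rw [Real.norm_eq_abs, abs_of_nonneg (Real.sqrt_nonneg _)]
    refine Real.sqrt_le_iff.2 ⟨add_nonneg (hF0 x) (hG0 x), ?_⟩
    simp only [Pi.add_apply]
    nlinarith [sq_nonneg (F x), sq_nonneg (G x), mul_nonneg (hF0 x) (hG0 x)]
  have ht : 0 < √δ := Real.sqrt_pos.2 hδ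
  have hts : √δ * √δ = δ := Real.mul_self_sqrt hδ.le
  have ht1 : √δ ≤ 1 := Real.sqrt_le_one.2 hδ1
  have hti : (√δ)⁻¹ * δ = √δ := by
    rw [inv_mul_eq_div, div_eq_iff ht.ne', hts]
  have hti1 : 1 ≤ (√δ)⁻¹ := (one_le_inv₀ ht).2 ht1
  -- weighted AM-GM, with the weights chosen oppositely on the event and on its complement
  have h1 := integral_sqrt_mul_le hF.integrableOn hG.integrableOn hF0 hG0 (μ := μ.restrict A) ht
  have h2 := integral_sqrt_mul_le hF.integrableOn hG.integrableOn hF0 hG0 (μ := μ.restrict Aᶜ)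
    (inv_pos.2 ht)
  rw [inv_inv] at h2
  have h3 := integral_add_compl hA hint
  have h4 := integral_add_compl hA hF
  have h5 := integral_add_compl hA hG
  rw [hF1] at h4
  rw [hG1] at h5
  set p := ∫ x in A, F x ∂μ
  set q := ∫ x in A, G x ∂μ
  have h6 : ∫ x in Aᶜ, F x ∂μ = 1 - p := by linarith
  have h7 : ∫ x in Aᶜ, G x ∂μ = 1 - q := by linarith
  rw [h6, h7] at h2
  have h8 : ((√δ)⁻¹ - √δ) * (q + (1 - p)) ≤ ((√δ)⁻¹ - √δ) * (2 * δ) := by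
    refine mul_le_mul_of_nonneg_left ?_ ?_ <;> linarith
  rw [← h3]
  nlinarith

theorem pi_densityLaw_real {f : ℝ → ℝ} (hf : Integrable f) (hf0 : ∀ x, 0 ≤ f x)
    (hf1 : ∫ x, f x = 1) (n : ℕ) {A : Set (Fin n → ℝ)} (hA : MeasurableSet A) :
    (Measure.pi fun _ : Fin n => densityLaw f).real A = ∫ x in A, ∏ l, f (x l) := by
  have : IsProbabilityMeasure (densityLaw f) :=
    isProbabilityMeasure_densityLaw hf0 hf1
  have hprod0 : ∀ x : Fin n → ℝ, 0 ≤ ∏ l, f (x l) := fun x =>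
    Finset.prod_nonneg fun l _ => hf0 _
  have hprod : Integrable fun x : Fin n → ℝ => ∏ l, f (x l) :=
    Integrable.fintype_prod (f := fun _ => f) fun _ => hf
  have key : (Measure.pi fun _ : Fin n => densityLaw f) =
      volume.withDensity fun x => ENNReal.ofReal (∏ l, f (x l)) := by
    refine Measure.pi_eq fun s hs => ?_
    rw [withDensity_apply _ (MeasurableSet.univ_pi hs),
      ← ofReal_integral_eq_lintegral_ofReal hprod.integrableOn
        (Filter.Eventually.of_forall hprod0), volume_pi, Measure.restrict_pi_pi,
      integral_fintype_prod_eq_prod (fun _ => f),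
      ENNReal.ofReal_prod_of_nonneg fun l _ => integral_nonneg hf0]
    refine Finset.prod_congr rfl fun l _ => ?_
    rw [withDensity_apply _ (hs l), ← ofReal_integral_eq_lintegral_ofReal hf.integrableOn
      (Filter.Eventually.of_forall hf0)]
  rw [key, measureReal_def, withDensity_apply _ hA,
    ← ofReal_integral_eq_lintegral_ofReal hprod.integrableOn
      (Filter.Eventually.of_forall hprod0),
    ENNReal.toReal_ofReal (integral_nonneg hprod0)]

/-- The affinity of the `n`-fold products is the `n`th power of the affinity, so that a successful
test between them bounds that power. -/
theorem affinity_pow_le_of_test {f₀ f₁ : ℝ → ℝ} (h0 : Integrable f₀) (h1 : Integrable f₁)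
    (h0n : ∀ x, 0 ≤ f₀ x) (h1n : ∀ x, 0 ≤ f₁ x) (h0i : ∫ x, f₀ x = 1) (h1i : ∫ x, f₁ x = 1)
    {n : ℕ} {A : Set (Fin n → ℝ)} (hA : MeasurableSet A) {δ : ℝ} (hδ : 0 < δ) (hδ1 : δ ≤ 1)
    (hA0 : 1 - δ ≤ (Measure.pi fun _ : Fin n => densityLaw f₀).real A)
    (hA1 : (Measure.pi fun _ : Fin n => densityLaw f₁).real A ≤ δ) :
    (∫ x, √(f₀ x * f₁ x)) ^ n ≤ √δ * (2 - δ) := by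
  rw [pi_densityLaw_real h0 h0n h0i n hA] at hA0
  rw [pi_densityLaw_real h1 h1n h1i n hA] at hA1
  have hone : ∀ f : ℝ → ℝ, ∫ x, f x = 1 → ∫ x : Fin n → ℝ, ∏ l, f (x l) = 1 := fun f hf => by
    rw [integral_fintype_prod_volume_eq_pow f, hf, one_pow]
  have h := affinity_le_of_test (Integrable.fintype_prod (f := fun _ : Fin n => f₀) fun _ => h0)
    (Integrable.fintype_prod (f := fun _ : Fin n => f₁) fun _ => h1)
    (fun x => Finset.prod_nonneg fun l _ => h0n _) (fun x => Finset.prod_nonneg fun l _ => h1n _)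
    (hone f₀ h0i) (hone f₁ h1i) hA hδ hδ1 hA0 hA1
  refine le_trans (le_of_eq ?_) h
  have : ∀ x : Fin n → ℝ, √((∏ l, f₀ (x l)) * ∏ l, f₁ (x l)) = ∏ l, √(f₀ (x l) * f₁ (x l)) := by
    intro x
    rw [← Finset.prod_mul_distrib, Real.sqrt_prod _ fun l _ => mul_nonneg (h0n _) (h1n _)]
  simp_rw [this]
  rw [integral_fintype_prod_eq_pow (fun x => √(f₀ x * f₁ x)), Fintype.card_fin]

/-- Up to level `1/4`, the bound of a successful test is smaller than `δ ^ (1 / 16)`. -/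
theorem sqrt_mul_two_sub_lt {δ : ℝ} (hδ : 0 < δ) (hδ4 : δ ≤ 1 / 4) :
    √δ * (2 - δ) < Real.exp (-(Real.log (1 / δ) / 16)) := by
  set q := Real.exp (-(Real.log (1 / δ) / 16)) with hq
  have hq0 : 0 < q := Real.exp_pos _
  have hq16 : q ^ 16 = δ := by
    rw [hq, ← Real.exp_nat_mul, one_div, Real.log_inv]
    rw [show ((16 : ℕ) : ℝ) * -(-Real.log δ / 16) = Real.log δ by push_cast; ring,
      Real.exp_log hδ]
  have hq8 : √δ = q ^ 8 := by
    rw [← hq16, show q ^ 16 = (q ^ 8) ^ 2 by ring, Real.sqrt_sq (by positivity)]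
  have h2 : δ * (2 - δ) ^ 2 ≤ 49 / 64 := by
    nlinarith [mul_nonneg (sub_nonneg.2 hδ4) (sub_nonneg.2 hδ4), mul_nonneg hδ.le (sub_nonneg.2 hδ4)]
  -- the sixteenth power of `q ^ 7 (2 - δ)` is `(δ (2 - δ) ^ 2) ^ 7 (2 - δ) ^ 2`
  have h3 : (q ^ 7 * (2 - δ)) ^ 16 < 1 := by
    calc (q ^ 7 * (2 - δ)) ^ 16 = ((q ^ 16) * (2 - δ) ^ 2) ^ 7 * (2 - δ) ^ 2 := by ring
      _ = (δ * (2 - δ) ^ 2) ^ 7 * (2 - δ) ^ 2 := by rw [hq16]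
      _ ≤ (49 / 64) ^ 7 * 2 ^ 2 := by
          gcongr <;> linarith
      _ < 1 := by norm_num
  have h4 : q ^ 7 * (2 - δ) < 1 := by
    by_contra hcon
    exact absurd h3 (not_lt.2 (one_le_pow₀ (not_lt.1 hcon)))
  rw [hq8]
  calc q ^ 8 * (2 - δ) = q * (q ^ 7 * (2 - δ)) := by ring
    _ < q * 1 := by gcongr
    _ = q := mul_one q

/-! ### The lower bound -/

theorem measurable_eval (β γ x₀ : ℝ) : Measurable fun f : HolderDensityAt β γ x₀ => f.1 x₀ := by
  have : BorelSpace (HolderDensityAt β γ x₀) := ⟨rfl⟩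
  have hc : Continuous fun f : HolderDensityAt β γ x₀ => f.1 x₀ := continuous_induced_dom
  exact hc.measurable

theorem exists_lt_of_lossQuantile_lt {X : Type*} [MeasurableSpace X] {P : Measure X}
    [IsProbabilityMeasure P] {δ R : ℝ} {ℓ : X → ℝ}
    (h : lossQuantile δ P ℓ < ENNReal.ofReal R) :
    ∃ r : ℝ, r < R ∧ 1 - δ ≤ P.real {x | ℓ x ≤ r} := by
  rw [lossQuantile] at h
  simp only [iInf_lt_iff] at h
  obtain ⟨r, hr, hrR⟩ := h
  refine ⟨r, ?_, ?_⟩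
  · rwa [← ENNReal.ofReal_coe_nnreal, ENNReal.ofReal_lt_ofReal_iff_of_nonneg r.coe_nonneg] at hrR
  · rw [measureReal_def]
    exact (ENNReal.ofReal_le_iff_le_toReal (measure_ne_top _ _)).1 hr

theorem exists_lower_bound {β : ℝ} (hβ : 0 < β) :
    ∃ c : ℝ, 0 < c ∧ ∀ θ : ℝ, 0 < θ → ∀ n : ℕ, 1 ≤ n → ∀ x₀ δ : ℝ, 0 < δ → δ ≤ 1 / 4 →
      ENNReal.ofReal (c * kdeRate β (θ ^ (β + 1)) n δ) ≤
        minimaxQuantile δ (iidModel β (θ ^ (β + 1)) x₀ n) (pointLoss β (θ ^ (β + 1)) x₀) := by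
  obtain ⟨s, hs, hyp⟩ := exists_close_holderDensities hβ
  refine ⟨s ^ 2 / 4, by positivity, fun θ hθ n hn x₀ δ hδ hδ4 => ?_⟩
  have hn0 : (0 : ℝ) < n := by exact_mod_cast hn
  set L := Real.log (1 / δ) with hL
  have hL0 : 0 < L := Real.log_pos (by rw [lt_div_iff₀ hδ]; linarith)
  -- the width of the perturbation is chosen such that the two product measures cannot be
  -- separated at level `δ`
  set y := min (L / n) 1 with hy
  have hy0 : 0 < y := by positivity
  have hy1 : y ≤ 1 := min_le_right _ _
  set h := y ^ (1 / (2 * β + 1)) with hh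
  have hh0 : 0 < h := Real.rpow_pos_of_pos hy0 _
  have hh1 : h ≤ 1 := Real.rpow_le_one hy0.le hy1 (by positivity)
  have hhy : h ^ (2 * β + 1) = y := by
    rw [hh, ← Real.rpow_mul hy0.le, one_div_mul_cancel (by positivity), Real.rpow_one]
  obtain ⟨f₀, f₁, hf₀, hf₁, hdiff, haff⟩ := hyp θ hθ x₀ h hh0 hh1
  have hrate : s ^ 2 / 4 * kdeRate β (θ ^ (β + 1)) n δ = (s * θ * h ^ β / 2) ^ 2 := by
    have h1 : (h ^ β) ^ 2 = min ((L / n) ^ (2 * β / (2 * β + 1))) 1 := by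
      have h2 : (h ^ β) ^ 2 = y ^ (2 * β / (2 * β + 1)) := by
        rw [hh, ← Real.rpow_mul hy0.le, ← Real.rpow_natCast, ← Real.rpow_mul hy0.le]
        congr 1
        push_cast; ring
      rw [h2, hy]
      rcases le_total (L / n) 1 with h3 | h3
      · rw [min_eq_left h3, min_eq_left (Real.rpow_le_one (by positivity) h3 (by positivity))]
      · rw [min_eq_right h3, min_eq_right (Real.one_le_rpow h3 (by positivity)), Real.one_rpow]
    rw [kdeRate, ← h1, ← Real.rpow_mul hθ.le, mul_div_cancel₀ _ (by positivity), Real.rpow_two]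
    ring
  rw [hrate]
  refine le_iInf₂ fun est hest => ?_
  by_contra hcon
  rw [not_le] at hcon
  let F₀ : HolderDensityAt β (θ ^ (β + 1)) x₀ := ⟨f₀, hf₀⟩
  let F₁ : HolderDensityAt β (θ ^ (β + 1)) x₀ := ⟨f₁, hf₁⟩
  have hp₀ := hf₀.isProbabilityMeasure
  have hp₁ := hf₁.isProbabilityMeasure
  have hq : ∀ F : HolderDensityAt β (θ ^ (β + 1)) x₀, lossQuantile δ
      (Measure.pi fun _ : Fin n => densityLaw F.1)
      (fun x => pointLoss β (θ ^ (β + 1)) x₀ (est x) F) <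
        ENNReal.ofReal ((s * θ * h ^ β / 2) ^ 2) := fun F =>
    have hF : (Measure.pi fun _ : Fin n => densityLaw F.1) ∈
      iidModel β (θ ^ (β + 1)) x₀ n F := Set.mem_singleton _
    lt_of_le_of_lt (le_iSup_of_le F (le_iSup₂ (f := fun P (_ : P ∈ iidModel β (θ ^ (β + 1)) x₀ n F) =>
      lossQuantile δ P fun x => pointLoss β (θ ^ (β + 1)) x₀ (est x) F) _ hF)) hcon
  obtain ⟨r₀, hr₀, hP₀⟩ := exists_lt_of_lossQuantile_lt (P := Measure.pi fun _ : Fin n =>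
    densityLaw f₀) (hq F₀)
  obtain ⟨r₁, hr₁, hP₁⟩ := exists_lt_of_lossQuantile_lt (P := Measure.pi fun _ : Fin n =>
    densityLaw f₁) (hq F₁)
  have hm : ∀ (F : HolderDensityAt β (θ ^ (β + 1)) x₀) (r : ℝ),
      MeasurableSet {x | pointLoss β (θ ^ (β + 1)) x₀ (est x) F ≤ r} := fun F r =>
    measurableSet_le ((((measurable_eval _ _ _).comp hest).sub_const _).pow_const 2)
      measurable_const
  set A := {x | pointLoss β (θ ^ (β + 1)) x₀ (est x) F₀ ≤ r₀} with hA
  set A' := {x | pointLoss β (θ ^ (β + 1)) x₀ (est x) F₁ ≤ r₁} with hA'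
  have hb0 : 0 < s * θ * h ^ β := by positivity
  have hdisj : A ⊆ A'ᶜ := by
    intro x hx hx'
    have e0 : ((est x).1 x₀ - f₀ x₀) ^ 2 < (s * θ * h ^ β / 2) ^ 2 := lt_of_le_of_lt hx hr₀
    have e1 : ((est x).1 x₀ - f₁ x₀) ^ 2 < (s * θ * h ^ β / 2) ^ 2 := lt_of_le_of_lt hx' hr₁
    have e2 := abs_lt.1 (abs_lt_of_sq_lt_sq e0 (by positivity))
    have e3 := abs_lt.1 (abs_lt_of_sq_lt_sq e1 (by positivity))
    linarith
  have hA1 : (Measure.pi fun _ : Fin n => densityLaw f₁).real A ≤ δ := by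
    refine (measureReal_mono hdisj).trans ?_
    rw [probReal_compl_eq_one_sub (hm F₁ r₁)]
    linarith
  have htest := affinity_pow_le_of_test hf₀.integrable hf₁.integrable hf₀.nonneg hf₁.nonneg
    hf₀.integral_eq_one hf₁.integral_eq_one (hm F₀ r₀) hδ (by linarith) hP₀ hA1
  have hexp : Real.exp (-(y / 16)) ≤ ∫ x, √(f₀ x * f₁ x) := by
    refine le_trans ?_ haff
    rw [hhy, Real.exp_neg]
    have h1 := Real.add_one_le_exp (y / 16)
    refine inv_le_of_inv_le₀ (by linarith) (le_trans ?_ h1)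
    refine inv_le_of_inv_le₀ (by linarith) ?_
    rw [inv_le_iff_one_le_mul₀ (by linarith)]
    nlinarith
  have hpow : Real.exp (-(L / 16)) ≤ (∫ x, √(f₀ x * f₁ x)) ^ n := by
    refine le_trans ?_ (pow_le_pow_left₀ (Real.exp_pos _).le hexp n)
    rw [← Real.exp_nat_mul, Real.exp_le_exp]
    have h1 : n * y ≤ L := by
      calc n * y ≤ n * (L / n) := by gcongr; exact min_le_left _ _
        _ = L := by field_simp
    linarith
  exact absurd (hpow.trans htest) (not_le.2 (sqrt_mul_two_sub_lt hδ hδ4))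

/-! ### The minimax rate -/

theorem nonempty_holderDensityAt {β θ : ℝ} (hβ : 0 < β) (hθ : 0 < θ) (x₀ : ℝ) :
    Nonempty (HolderDensityAt β (θ ^ (β + 1)) x₀) := by
  obtain ⟨s, -, hyp⟩ := exists_close_holderDensities hβ
  obtain ⟨f₀, -, hf₀, -⟩ := hyp θ hθ x₀ 1 one_pos le_rfl
  exact ⟨⟨f₀, hf₀⟩⟩

theorem mainTheorem10 (β : ℝ) (hβ : 0 < β) :
    ∃ c C : ℝ, 0 < c ∧ 0 < C ∧
      ∀ (γ : ℝ), 0 < γ → ∀ (n : ℕ), 1 ≤ n → ∀ (x₀ : ℝ),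
        (∀ δ : ℝ, 0 < δ → δ ≤ 1 / 4 →
          ENNReal.ofReal (c * kdeRate β γ n δ) ≤
              minimaxQuantile δ (iidModel β γ x₀ n) (pointLoss β γ x₀) ∧
            minimaxQuantile δ (iidModel β γ x₀ n) (pointLoss β γ x₀) ≤
              ENNReal.ofReal (C * kdeRate β γ n δ)) ∧
        ∃ est : (Fin n → ℝ) → HolderDensityAt β γ x₀, Measurable est ∧
          ∀ δ : ℝ, 0 < δ → δ ≤ 1 / 4 →
            worstCaseQuantile δ (iidModel β γ x₀ n) (pointLoss β γ x₀) est ≤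
              ENNReal.ofReal (C * kdeRate β γ n δ) := by
  obtain ⟨c, hc, hlower⟩ := exists_lower_bound hβ
  have hE := errorConst_pos β
  refine ⟨c, 18 * errorConst β ^ 2 + 2 * holderSup β ^ 2, hc, by positivity,
    fun γ hγ n hn x₀ => ?_⟩
  -- `1 / θ` is the length scale of the Hölder class
  obtain ⟨θ, hθ, rfl⟩ : ∃ θ : ℝ, 0 < θ ∧ γ = θ ^ (β + 1) :=
    ⟨γ ^ (1 / (β + 1)), Real.rpow_pos_of_pos hγ _, by
      rw [← Real.rpow_mul hγ.le, one_div_mul_cancel (by positivity), Real.rpow_one]⟩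
  have := nonempty_holderDensityAt hβ hθ x₀
  obtain ⟨est, hest, hupper⟩ := exists_estimator hβ hθ hn x₀
  exact ⟨fun δ hδ hδ4 => ⟨hlower θ hθ n hn x₀ δ hδ hδ4,
    (iInf₂_le est hest).trans (hupper δ hδ hδ4)⟩, est, hest, hupper⟩
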